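/- Let $N\ge 1$, let $\mathbb D$ be the open unit ball of $\mathbb R^{N+1}$ with the Poincaré metric $d$, $\mathbb S=\partial\mathbb D$, $\overline{\mathbb D}=\mathbb D\cup\mathbb S$. Let $G$ be a Kleinian group, i.e. a discrete group of orientation-preserving isometries of $\mathbb D$, acting on $\overline{\mathbb D}$ by homeomorphisms. For $g\in G$ and $z\in\overline{\mathbb D}$ let $$j(g,z)=\frac{1-|w|^2}{1-2\langle z,w\rangle+|z|^2|w|^2},\qquad w=g^{-1}(0),$$ be the conformal derivative of $g$ at $z$. Let $s>0$. *Definitions.* The limit set is $L(G)=\overline{G(0)}\setminus G(0)$. The big horospherical limit set $L_H(G)$ consists of all $\zeta\in L(G)$ for which there is $c>0$ such that the orbit $G(0)$ accumulates at $\zeta$ within the horoball $\{z\in\mathbb D : (1-|z|^2)/|\zeta-z|^2>c\}$. A Borel probability measure $\mu$ on $\overline{\mathbb D}$ is *$s$-conformal* for $G$ if $\mu(g(B))=\int_B j(g,z)^s\,d\mu(z)$ for all $g\in G$ and all Borel sets $B\subseteq\overline{\mathbb D}$. A *Dirichlet fundamental domain* of $G$ is a set $F=\{z\in\mathbb D :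 d(z,a)<d(z,g(a))\text{ for all } g\in G\setminus\{1\}\}$, where $a\in\mathbb D$ is fixed by no non-trivial element of $G$. An *ending sequence* in $F$ tending to $\zeta\in\mathbb S$ is a sequence $(z_n)$ in $F$ that converges to $\zeta$ in the Euclidean metric and stays within a bounded hyperbolic distance of some geodesic ray towards $\zeta$ contained in $F$. If $P(z,s)=\sum_{g\in G}j(g,z)^s<\infty$ for all $z\in\mathbb D$, then an *$s$-conformal ending measure* for $G$ is any probability measure on $\overline{\mathbb D}$ that is the weak limit of a subsequence of $$\mu_n=\frac1{P(z_n,s)}\sum_{g\in G}j(g,z_n)^s\,\mathbf 1_{g(z_n)}$$ for some ending sequence $(z_n)$ in some Dirichlet fundamental domain of $G$; here $\mathbf 1_x$ is the unit point mass at $x$. An element of $G$ is *parabolic* if it has precisely one fixed point in $\mathbb S$. **Proposition.** Suppose that there are an $s$-conformal measure $\mu$ for $G$ and a $G$-invariant Borel set $A\subseteq\mathbb S$ with $\mu(A\setminus L_H(G))>0$. Then there is an $s$-conformal ending measure $\nu$ for $G$ (in particular, $P(z,s)<\infty$ for all $z\in\mathbb D$, and $\nu$ is an $s$-conformal measure for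 $G$) such that $\nu$ is purely atomic (carried by a countable set), $\nu$ is essentially supported on $A$ (i.e. $\nu(\overline{\mathbb D}\setminus A)=0$), and no atom of $\nu$ is fixed by a parabolic element of $G$. -/

import Mathlib

open MeasureTheory Filter Topology Set
open scoped RealInnerProductSpace

noncomputable section

namespace Kleinian

/-- The closed unit ball of Euclidean space of dimension `N + 1`; its open part is the Poincaré
ball model of hyperbolic space, its boundary the sphere of dimension `N`. -/
abbrev ClosedUnitBall (N : ℕ) : Type :=
  Metric.closedBall (0 : EuclideanSpace ℝ (Fin (N + 1))) 1

variable {N : ℕ}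

/-- The open unit ball, i.e. hyperbolic space. -/
def hypSpace (N : ℕ) : Set (ClosedUnitBall N) := {z | ‖(z : EuclideanSpace ℝ (Fin (N + 1)))‖ < 1}

/-- The boundary sphere. -/
def bdSphere (N : ℕ) : Set (ClosedUnitBall N) := {z | ‖(z : EuclideanSpace ℝ (Fin (N + 1)))‖ = 1}

/-- The centre of the ball. -/
def origin (N : ℕ) : ClosedUnitBall N := ⟨0, by simp⟩

/-- The hyperbolic distance (curvature `-1`) of the Poincaré ball model,
`sinh (d / 2) = |z - w| / √((1 - |z|²) (1 - |w|²))`; meaningful for points of `hypSpace N`. -/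
def hypDist (z w : ClosedUnitBall N) : ℝ :=
  2 * Real.arsinh (‖(z : EuclideanSpace ℝ (Fin (N + 1))) - w‖ /
    Real.sqrt ((1 - ‖(z : EuclideanSpace ℝ (Fin (N + 1)))‖ ^ 2) *
      (1 - ‖(w : EuclideanSpace ℝ (Fin (N + 1)))‖ ^ 2)))

open Classical in
/-- A self-map of the closed ball as a map of the ambient Euclidean space (the identity
outside the ball), in order to speak of its derivative at interior points. -/
def ambientMap (g : ClosedUnitBall N ≃ₜ ClosedUnitBall N) (x : EuclideanSpace ℝ (Fin (N + 1))) :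
    EuclideanSpace ℝ (Fin (N + 1)) :=
  if h : x ∈ Metric.closedBall (0 : EuclideanSpace ℝ (Fin (N + 1))) 1 then
    (g ⟨x, h⟩ : EuclideanSpace ℝ (Fin (N + 1))) else x

/-- The homeomorphisms of the closed ball which restrict to an orientation-preserving hyperbolic
isometry of the open ball. Each such isometry of the open ball extends in exactly one way
to a homeomorphism of the closed ball. -/
structure IsConformalAut (g : ClosedUnitBall N ≃ₜ ClosedUnitBall N) : Prop where
  mem_hypSpace_iff : ∀ z, g z ∈ hypSpace N ↔ z ∈ hypSpace N
  isometry : ∀ z ∈ hypSpace N, ∀ w ∈ hypSpace N, hypDist (g z) (g w) = hypDist z w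
  orientation : ∀ z ∈ hypSpace N,
    0 < (fderiv ℝ (ambientMap g) (z : EuclideanSpace ℝ (Fin (N + 1)))).det

/-- Kleinian groups: groups of conformal automorphisms which are discrete, i.e. the identity is
isolated in the topology of uniform convergence on the closed ball. -/
structure IsKleinian (G : Subgroup (ClosedUnitBall N ≃ₜ ClosedUnitBall N)) : Prop where
  conformal : ∀ g ∈ G, IsConformalAut g
  discrete : ∃ ε > 0, ∀ g ∈ G, (∀ z, dist (g z) z < ε) → g = 1

/-- A conformal automorphism is parabolic if it has precisely one fixed point on the sphere. -/
def IsParabolic (g : ClosedUnitBall N ≃ₜ ClosedUnitBall N) : Prop :=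
  IsConformalAut g ∧ ∃! ζ, ζ ∈ bdSphere N ∧ g ζ = ζ

/-- The conformal derivative `j(g, z) = (1 - |w|²) / (|z* - w|² |z|²)` with `w = g⁻¹(0)` and `z*`
the image of `z` under reflection in the unit sphere. Here `|z* - w|² |z|²` is written in its
expanded form `1 - 2 ⟨z, w⟩ + |z|² |w|²`, which makes sense at `z = 0` as well. -/
def confDeriv (g : ClosedUnitBall N ≃ₜ ClosedUnitBall N) (z : ClosedUnitBall N) : ℝ :=
  (1 - ‖(g.symm (origin N) : EuclideanSpace ℝ (Fin (N + 1)))‖ ^ 2) /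
    (1 - 2 * ⟪(z : EuclideanSpace ℝ (Fin (N + 1))),
          (g.symm (origin N) : EuclideanSpace ℝ (Fin (N + 1)))⟫
      + ‖(z : EuclideanSpace ℝ (Fin (N + 1)))‖ ^ 2 *
        ‖(g.symm (origin N) : EuclideanSpace ℝ (Fin (N + 1)))‖ ^ 2)

/-- The Poisson kernel `k(z, ζ)`. -/
def poissonKernel (z ζ : ClosedUnitBall N) : ℝ :=
  (1 - ‖(z : EuclideanSpace ℝ (Fin (N + 1)))‖ ^ 2) /
    ‖(ζ : EuclideanSpace ℝ (Fin (N + 1))) - z‖ ^ 2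

/-- The open horoball `H_ζ(c)`. -/
def horoball (ζ : ClosedUnitBall N) (c : ℝ) : Set (ClosedUnitBall N) :=
  {z | z ∈ hypSpace N ∧ c < poissonKernel z ζ}

/-- The orbit `G(z)`. -/
def orbit (G : Subgroup (ClosedUnitBall N ≃ₜ ClosedUnitBall N)) (z : ClosedUnitBall N) :
    Set (ClosedUnitBall N) := {w | ∃ g ∈ G, g z = w}

/-- The limit set `L(G)`. -/
def limitSet (G : Subgroup (ClosedUnitBall N ≃ₜ ClosedUnitBall N)) : Set (ClosedUnitBall N) :=
  closure (orbit G (origin N)) \ orbit G (origin N)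

/-- The big horospherical limit set `L_H(G)`: limit points `ζ` at which the orbit of the origin
accumulates within some horoball at `ζ`. -/
def bigHorosphericalLimitSet (G : Subgroup (ClosedUnitBall N ≃ₜ ClosedUnitBall N)) :
    Set (ClosedUnitBall N) :=
  {ζ | ζ ∈ limitSet G ∧ ∃ c > 0, AccPt ζ (𝓟 (orbit G (origin N) ∩ horoball ζ c))}

/-- An `s`-conformal measure for `G`: a Borel probability measure on the closed ball with
`μ(g(B)) = ∫_B j(g, z)^s dμ(z)` for all `g ∈ G` and all Borel sets `B`. -/
structure IsConformalMeasure (G : Subgroup (ClosedUnitBall N ≃ₜ ClosedUnitBall N)) (s : ℝ)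
    (μ : Measure (ClosedUnitBall N)) : Prop where
  prob : IsProbabilityMeasure μ
  conformal : ∀ g ∈ G, ∀ B : Set (ClosedUnitBall N), MeasurableSet B →
    μ (g '' B) = ∫⁻ z in B, ENNReal.ofReal (confDeriv g z ^ s) ∂μ

/-- The Dirichlet fundamental domain of `G` with centre `a`. -/
def dirichletDomain (G : Subgroup (ClosedUnitBall N ≃ₜ ClosedUnitBall N)) (a : ClosedUnitBall N) :
    Set (ClosedUnitBall N) :=
  {z | z ∈ hypSpace N ∧ ∀ g ∈ G, g ≠ 1 → hypDist z a < hypDist z (g a)}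

/-- `F` is a Dirichlet fundamental domain of `G`: its centre is a point of hyperbolic space
fixed by no non-trivial element of `G`. -/
def IsDirichletDomain (G : Subgroup (ClosedUnitBall N ≃ₜ ClosedUnitBall N))
    (F : Set (ClosedUnitBall N)) : Prop :=
  ∃ a ∈ hypSpace N, (∀ g ∈ G, g a = a → g = 1) ∧ F = dirichletDomain G a

/-- `γ`, restricted to `[0, ∞)`, is a geodesic ray of hyperbolic space towards the boundary
point `ζ`, parametrised by hyperbolic arc length. -/
structure IsGeodesicRay (γ : ℝ → ClosedUnitBall N) (ζ : ClosedUnitBall N) : Prop where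
  mem : ∀ t, 0 ≤ t → γ t ∈ hypSpace N
  isometry : ∀ t, 0 ≤ t → ∀ u, 0 ≤ u → hypDist (γ t) (γ u) = |t - u|
  tendsto : Tendsto γ atTop (𝓝 ζ)

/-- An ending sequence in `F` tending to the boundary point `ζ`: its points lie in `F`, within
bounded hyperbolic distance of a geodesic ray towards `ζ` contained in `F`, and it converges
to `ζ` in the Euclidean metric. -/
structure IsEndingSequence (F : Set (ClosedUnitBall N)) (ζ : ClosedUnitBall N)
    (z : ℕ → ClosedUnitBall N) : Prop where
  mem_sphere : ζ ∈ bdSphere N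
  mem : ∀ n, z n ∈ F
  near_ray : ∃ γ : ℝ → ClosedUnitBall N, IsGeodesicRay γ ζ ∧ (∀ t, 0 ≤ t → γ t ∈ F) ∧
    ∃ R : ℝ, ∀ n, ∃ t, 0 ≤ t ∧ hypDist (z n) (γ t) ≤ R
  tendsto : Tendsto z atTop (𝓝 ζ)

/-- The Poincaré series `P(z, s) = ∑_{g ∈ G} j(g, z)^s`, with values in `[0, ∞]`. -/
def poincareSeries (G : Subgroup (ClosedUnitBall N ≃ₜ ClosedUnitBall N)) (z : ClosedUnitBall N)
    (s : ℝ) : ENNReal :=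
  ∑' g : G, ENNReal.ofReal (confDeriv (g : ClosedUnitBall N ≃ₜ ClosedUnitBall N) z ^ s)

/-- The atomic measure `P(z, s)⁻¹ ∑_{g ∈ G} j(g, z)^s 1_{g(z)}`. -/
def orbitMeasure (G : Subgroup (ClosedUnitBall N ≃ₜ ClosedUnitBall N)) (s : ℝ)
    (z : ClosedUnitBall N) : Measure (ClosedUnitBall N) :=
  (poincareSeries G z s)⁻¹ • Measure.sum fun g : G =>
    ENNReal.ofReal (confDeriv (g : ClosedUnitBall N ≃ₜ ClosedUnitBall N) z ^ s) •
      Measure.dirac ((g : ClosedUnitBall N ≃ₜ ClosedUnitBall N) z)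

/-- An `s`-conformal ending measure for `G`: the Poincaré series converges at the exponent `s`, and
`ν` is a weak limit of a subsequence of the orbit measures along an ending sequence in some
Dirichlet fundamental domain. -/
structure IsEndingMeasure (G : Subgroup (ClosedUnitBall N ≃ₜ ClosedUnitBall N)) (s : ℝ)
    (ν : Measure (ClosedUnitBall N)) : Prop where
  prob : IsProbabilityMeasure ν
  converges : ∀ z ∈ hypSpace N, poincareSeries G z s < ⊤
  weak_limit : ∃ (F : Set (ClosedUnitBall N)) (ζ : ClosedUnitBall N) (z : ℕ → ClosedUnitBall N)
    (φ : ℕ → ℕ), IsDirichletDomain G F ∧ IsEndingSequence F ζ z ∧ StrictMono φ ∧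
      ∀ f : C(ClosedUnitBall N, ℝ),
        Tendsto (fun n => ∫ x, f x ∂(orbitMeasure G s (z (φ n)))) atTop (𝓝 (∫ x, f x ∂ν))

/-- A probability measure is purely atomic if it is carried by a countable set. -/
def IsPurelyAtomic (ν : Measure (ClosedUnitBall N)) : Prop :=
  ∃ C : Set (ClosedUnitBall N), C.Countable ∧ ν Cᶜ = 0

end Kleinian

end

/-!
The ending measure is the orbit measure of a single boundary point `ζ ∈ A`, namely the normalisation
of `∑ j(g, ζ)^s 1_{g(ζ)}`, where `ζ` is a point at infinity of a Dirichlet domain at which the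
Poincaré series converges.

*Möbius identities.* Written through the hyperbolic cosine of the distance, the isometry property
of the elements of `G` says `1 - |g z|² = j(g, z) (1 - |z|²)` and
`|g z - g w|² = j(g, z) j(g, w) |z - w|²` in the open ball, and both identities, as well as the
chain rule for `j`, pass to the closed ball by density. They give Lipschitz bounds, hence proper
discontinuity (`IsKleinian.finite_norm_symm_le`), countability of `G`, and a centre `a` with trivial
stabiliser by Baire's theorem.

*Choice of `ζ`.* If `ζ` is not in `L_H(G)`, each horoball at `ζ` contains `g(a)` for finitely many
`g` only, so the maximum of the Poisson kernel over the orbit of `a` is attained, and finitely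
often. Thus the translates of the closed set `dirichletBoundary G a` cover `A \ L_H(G)` with finite
multiplicity. On a part `E` of it of positive measure the multiplicity is at most some `m`; then
`∫_E P(z, s) dμ = ∑ μ(g(E)) ≤ m`, so `P(ζ, s) < ∞` for almost all `ζ ∈ E`
(`IsKleinian.exists_mem_dirichletBoundary`).

*Convergence.* The geodesic ray from `a` to such a `ζ` stays in the Dirichlet domain
(`IsKleinian.exists_ray_in_dirichletDomain`) and approaches `ζ` nontangentially, whence
`j(g, z) ≤ K j(g, ζ)` along the ray, uniformly in `g`. By dominated convergence the orbit measures
along the ray tend to that of `ζ` (`IsKleinian.tendsto_orbitMeasure`), which is conformal by the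
chain rule and lives on the orbit of `ζ`.

*Parabolic elements.* At a fixed point of an element of infinite order the Poincaré series diverges,
since `j(gⁿ, ζ) = j(g, ζ)ⁿ`. An element of finite order fixes the barycentre of an orbit in the
hyperboloid model, hence with one boundary point also the other end of a geodesic, and is not
parabolic (`IsKleinian.exists_second_fixed_point`).
-/

noncomputable section

namespace Kleinian

variable {N : ℕ}

/-! ### The hyperbolic cosine of the distance -/

/-- The hyperbolic cosine of the distance of two points of the ball. In the hyperboloid model this
is minus the Lorentz product of the two points. -/
def coshDist (z w : ClosedUnitBall N) : ℝ :=
  1 + 2 * ‖z.1 - w.1‖ ^ 2 / ((1 - ‖z.1‖ ^ 2) * (1 - ‖w.1‖ ^ 2))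

theorem norm_le_one (z : ClosedUnitBall N) : ‖z.1‖ ≤ 1 :=
  mem_closedBall_zero_iff.1 z.2

theorem one_sub_normSq_nonneg (z : ClosedUnitBall N) : 0 ≤ 1 - ‖z.1‖ ^ 2 := by
  nlinarith [norm_le_one z, norm_nonneg z.1]

theorem one_sub_normSq_pos {z : ClosedUnitBall N} (hz : z ∈ hypSpace N) : 0 < 1 - ‖z.1‖ ^ 2 := by
  have : ‖z.1‖ < 1 := hz
  nlinarith [norm_nonneg z.1]

theorem origin_mem_hypSpace : origin N ∈ hypSpace N := by
  simp [hypSpace, origin]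

theorem mem_bdSphere_of_notMem {z : ClosedUnitBall N} (hz : z ∉ hypSpace N) : z ∈ bdSphere N :=
  le_antisymm (norm_le_one z) (not_lt.1 hz)

theorem ne_of_mem_hypSpace {z ζ : ClosedUnitBall N} (hz : z ∈ hypSpace N) (hζ : ζ ∈ bdSphere N) :
    ζ ≠ z := by
  rintro rfl
  exact (show ‖ζ.1‖ < 1 from hz).ne hζ

theorem normSq_sub_pos {z ζ : ClosedUnitBall N} (hz : z ∈ hypSpace N) (hζ : ζ ∈ bdSphere N) :
    0 < ‖ζ.1 - z.1‖ ^ 2 := by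
  have : ζ.1 - z.1 ≠ 0 := sub_ne_zero.2 fun h => ne_of_mem_hypSpace hz hζ (Subtype.ext h)
  positivity

theorem coshDist_comm (z w : ClosedUnitBall N) : coshDist z w = coshDist w z := by
  rw [coshDist, coshDist, norm_sub_rev, mul_comm (1 - ‖z.1‖ ^ 2)]

theorem coshDist_self (z : ClosedUnitBall N) : coshDist z z = 1 := by
  simp [coshDist]

theorem cosh_hypDist (z w : ClosedUnitBall N) : Real.cosh (hypDist z w) = coshDist z w := by
  rw [hypDist, Real.cosh_two_mul, Real.cosh_sq, Real.sinh_arsinh, div_pow, Real.sq_sqrt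
    (mul_nonneg (one_sub_normSq_nonneg z) (one_sub_normSq_nonneg w)), coshDist]
  ring

theorem hypDist_nonneg (z w : ClosedUnitBall N) : 0 ≤ hypDist z w := by
  have : 0 ≤ Real.arsinh (‖z.1 - w.1‖ / Real.sqrt ((1 - ‖z.1‖ ^ 2) * (1 - ‖w.1‖ ^ 2))) :=
    Real.arsinh_nonneg_iff.2 (by positivity)
  unfold hypDist
  linarith

theorem hypDist_lt_hypDist {z w z' w' : ClosedUnitBall N} (h : coshDist z w < coshDist z' w') :
    hypDist z w < hypDist z' w' := by
  rw [← cosh_hypDist, ← cosh_hypDist, Real.cosh_lt_cosh, abs_of_nonneg (hypDist_nonneg _ _),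
    abs_of_nonneg (hypDist_nonneg _ _)] at h
  exact h

theorem hypDist_eq_abs {z w : ClosedUnitBall N} {t : ℝ} (h : coshDist z w = Real.cosh t) :
    hypDist z w = |t| := by
  rw [← cosh_hypDist] at h
  have h1 := (Real.cosh_le_cosh.1 h.le)
  have h2 := (Real.cosh_le_cosh.1 h.ge)
  rw [abs_of_nonneg (hypDist_nonneg _ _)] at h1 h2
  exact le_antisymm h1 h2

theorem one_lt_coshDist {z w : ClosedUnitBall N} (hz : z ∈ hypSpace N) (hw : w ∈ hypSpace N)
    (h : z ≠ w) : 1 < coshDist z w := by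
  have h1 := one_sub_normSq_pos hz
  have h2 := one_sub_normSq_pos hw
  have h3 : 0 < ‖z.1 - w.1‖ := norm_pos_iff.2 (sub_ne_zero.2 fun h' => h (Subtype.ext h'))
  have : 0 < 2 * ‖z.1 - w.1‖ ^ 2 / ((1 - ‖z.1‖ ^ 2) * (1 - ‖w.1‖ ^ 2)) := by positivity
  unfold coshDist
  linarith

theorem dense_hypSpace : Dense (hypSpace N) := by
  intro z
  have hmem : ∀ n : ℕ, ‖((n : ℝ) / (n + 1)) • z.1‖ < 1 := by
    intro n
    rw [norm_smul, Real.norm_of_nonneg (by positivity)]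
    have h1 : (n : ℝ) / (n + 1) < 1 := by
      rw [div_lt_one (by positivity)]
      linarith
    have h0 : 0 ≤ (n : ℝ) / (n + 1) := by positivity
    nlinarith [norm_le_one z, norm_nonneg z.1]
  refine mem_closure_of_tendsto (f := fun n : ℕ =>
    (⟨((n : ℝ) / (n + 1)) • z.1, by simpa using (hmem n).le⟩ : ClosedUnitBall N)) (b := atTop) ?_
    (Eventually.of_forall hmem)
  rw [tendsto_subtype_rng]
  have := (tendsto_natCast_div_add_atTop (1 : ℝ)).smul_const z.1
  simpa using this

/-! ### The conformal derivative -/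

/-- The denominator of the conformal derivative. -/
def confDen (z w : ClosedUnitBall N) : ℝ := 1 - 2 * ⟪z.1, w.1⟫ + ‖z.1‖ ^ 2 * ‖w.1‖ ^ 2

theorem confDen_eq (z w : ClosedUnitBall N) :
    confDen z w = ‖z.1 - w.1‖ ^ 2 + (1 - ‖z.1‖ ^ 2) * (1 - ‖w.1‖ ^ 2) := by
  rw [confDen, norm_sub_sq_real]
  ring

theorem sq_le_confDen (z w : ClosedUnitBall N) : (1 - ‖z.1‖ * ‖w.1‖) ^ 2 ≤ confDen z w := by
  have := real_inner_le_norm z.1 w.1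
  rw [confDen]
  nlinarith

theorem sq_one_sub_norm_right_le (z w : ClosedUnitBall N) : (1 - ‖w.1‖) ^ 2 ≤ confDen z w := by
  refine le_trans ?_ (sq_le_confDen z w)
  have h1 := norm_le_one z
  have h2 := norm_le_one w
  apply pow_le_pow_left₀ <;> nlinarith [norm_nonneg w.1, norm_nonneg z.1]

theorem sq_one_sub_norm_left_le (z w : ClosedUnitBall N) : (1 - ‖z.1‖) ^ 2 ≤ confDen z w := by
  refine le_trans ?_ (sq_le_confDen z w)
  have h1 := norm_le_one z
  have h2 := norm_le_one w
  apply pow_le_pow_left₀ <;> nlinarith [norm_nonneg w.1, norm_nonneg z.1]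

theorem confDen_pos (z : ClosedUnitBall N) {w : ClosedUnitBall N} (hw : w ∈ hypSpace N) :
    0 < confDen z w := by
  have : ‖w.1‖ < 1 := hw
  exact lt_of_lt_of_le (by nlinarith) (sq_one_sub_norm_right_le z w)

theorem confDen_of_mem_bdSphere {ζ : ClosedUnitBall N} (hζ : ζ ∈ bdSphere N)
    (w : ClosedUnitBall N) : confDen ζ w = ‖ζ.1 - w.1‖ ^ 2 := by
  have : ‖ζ.1‖ = 1 := hζ
  rw [confDen_eq, this]
  ring

variable {g h : ClosedUnitBall N ≃ₜ ClosedUnitBall N}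

theorem confDeriv_eq (g : ClosedUnitBall N ≃ₜ ClosedUnitBall N) (z : ClosedUnitBall N) :
    confDeriv g z = (1 - ‖(g.symm (origin N)).1‖ ^ 2) / confDen z (g.symm (origin N)) := rfl

theorem IsConformalAut.symm_origin_mem (hg : IsConformalAut g) :
    g.symm (origin N) ∈ hypSpace N := by
  rw [← hg.mem_hypSpace_iff, g.apply_symm_apply]
  exact origin_mem_hypSpace

theorem IsConformalAut.confDeriv_pos (hg : IsConformalAut g) (z : ClosedUnitBall N) :
    0 < confDeriv g z :=
  div_pos (one_sub_normSq_pos hg.symm_origin_mem) (confDen_pos z hg.symm_origin_mem)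

theorem IsConformalAut.continuous_confDeriv (hg : IsConformalAut g) : Continuous (confDeriv g) := by
  refine Continuous.div continuous_const ?_ fun z => (confDen_pos z hg.symm_origin_mem).ne'
  fun_prop

theorem IsConformalAut.coshDist_apply (hg : IsConformalAut g) {z w : ClosedUnitBall N}
    (hz : z ∈ hypSpace N) (hw : w ∈ hypSpace N) : coshDist (g z) (g w) = coshDist z w := by
  rw [← cosh_hypDist, ← cosh_hypDist, hg.isometry z hz w hw]

theorem IsConformalAut.one_sub_normSq_apply_of_mem (hg : IsConformalAut g) {z : ClosedUnitBall N}
    (hz : z ∈ hypSpace N) : 1 - ‖(g z).1‖ ^ 2 = confDeriv g z * (1 - ‖z.1‖ ^ 2) := by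
  have hw := hg.symm_origin_mem
  have h1 := hg.coshDist_apply hz hw
  rw [g.apply_symm_apply] at h1
  have p1 := one_sub_normSq_pos ((hg.mem_hypSpace_iff z).2 hz)
  have p2 := one_sub_normSq_pos hz
  have p3 := one_sub_normSq_pos hw
  have p4 := confDen_pos z hw
  have h0 : (origin N).1 = 0 := rfl
  simp only [coshDist, h0, sub_zero, norm_zero] at h1
  rw [confDeriv_eq]
  have h2 := confDen_eq z (g.symm (origin N))
  rw [add_right_inj, div_eq_div_iff (by positivity) (by positivity)] at h1
  rw [div_mul_eq_mul_div, eq_div_iff p4.ne', h2]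
  linear_combination -h1 / 2

theorem IsConformalAut.one_sub_normSq_apply (hg : IsConformalAut g) (z : ClosedUnitBall N) :
    1 - ‖(g z).1‖ ^ 2 = confDeriv g z * (1 - ‖z.1‖ ^ 2) := by
  refine congrFun (Continuous.ext_on dense_hypSpace (f := fun z => 1 - ‖(g z).1‖ ^ 2)
    (g := fun z => confDeriv g z * (1 - ‖z.1‖ ^ 2)) ?_ ?_ fun z hz =>
      hg.one_sub_normSq_apply_of_mem hz) z
  · have := g.continuous
    fun_prop
  · have := hg.continuous_confDeriv
    fun_prop

/-- The conformal derivative controls the Euclidean distortion: the infinitesimal identity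
integrates to an exact one for Möbius maps. -/
theorem IsConformalAut.normSq_sub_apply (hg : IsConformalAut g) (z w : ClosedUnitBall N) :
    ‖(g z).1 - (g w).1‖ ^ 2 = confDeriv g z * confDeriv g w * ‖z.1 - w.1‖ ^ 2 := by
  have hc := hg.continuous_confDeriv
  have hc' := g.continuous
  refine congrFun (Continuous.ext_on ((dense_hypSpace (N := N)).prod (dense_hypSpace (N := N)))
    (f := fun p : ClosedUnitBall N × ClosedUnitBall N => ‖(g p.1).1 - (g p.2).1‖ ^ 2)
    (g := fun p => confDeriv g p.1 * confDeriv g p.2 * ‖p.1.1 - p.2.1‖ ^ 2)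
    (by fun_prop) (by fun_prop) ?_) (z, w)
  rintro ⟨z, w⟩ ⟨hz, hw⟩
  have h1 := hg.coshDist_apply hz hw
  have pz := one_sub_normSq_pos hz
  have pw := one_sub_normSq_pos hw
  have jz := hg.confDeriv_pos z
  have jw := hg.confDeriv_pos w
  rw [coshDist, coshDist, hg.one_sub_normSq_apply, hg.one_sub_normSq_apply, add_right_inj,
    div_eq_div_iff (by positivity) (by positivity)] at h1
  have h2 : (1 - ‖z.1‖ ^ 2) * (1 - ‖w.1‖ ^ 2) ≠ 0 := by positivity
  apply mul_right_cancel₀ h2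
  dsimp only
  linear_combination h1 / 2

theorem IsConformalAut.confDeriv_mul (hg : IsConformalAut g) (hh : IsConformalAut h)
    (hgh : IsConformalAut (g * h)) (z : ClosedUnitBall N) :
    confDeriv (g * h) z = confDeriv g (h z) * confDeriv h z := by
  have c1 := hg.continuous_confDeriv
  have c2 := hh.continuous_confDeriv
  have c3 := hgh.continuous_confDeriv
  have c4 := h.continuous
  refine congrFun (Continuous.ext_on dense_hypSpace (f := confDeriv (g * h))
    (g := fun z => confDeriv g (h z) * confDeriv h z) c3 (by fun_prop) fun z hz => ?_) z
  have := hgh.one_sub_normSq_apply z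
  apply mul_right_cancel₀ (one_sub_normSq_pos hz).ne'
  rw [← this, mul_assoc, ← hh.one_sub_normSq_apply, ← hg.one_sub_normSq_apply]
  rfl

/-- The reciprocal Poisson kernel; its superlevel sets are complements of horoballs at `ζ`. -/
def invPoisson (z ζ : ClosedUnitBall N) : ℝ := ‖ζ.1 - z.1‖ ^ 2 / (1 - ‖z.1‖ ^ 2)

theorem invPoisson_pos {z ζ : ClosedUnitBall N} (hz : z ∈ hypSpace N) (hζ : ζ ∈ bdSphere N) :
    0 < invPoisson z ζ :=
  div_pos (normSq_sub_pos hz hζ) (one_sub_normSq_pos hz)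

theorem continuous_invPoisson (z : ClosedUnitBall N) : Continuous (invPoisson z) := by
  unfold invPoisson
  fun_prop

theorem IsConformalAut.invPoisson_apply (hg : IsConformalAut g) (z ζ : ClosedUnitBall N) :
    invPoisson (g z) (g ζ) = confDeriv g ζ * invPoisson z ζ := by
  have := hg.confDeriv_pos z
  rw [invPoisson, invPoisson, hg.normSq_sub_apply, hg.one_sub_normSq_apply]
  rw [mul_comm (confDeriv g ζ), mul_assoc, mul_div_mul_left _ _ this.ne', mul_div_assoc]

theorem IsConformalAut.norm_symm_origin (hg : IsConformalAut g) :
    ‖(g.symm (origin N)).1‖ = ‖(g (origin N)).1‖ := by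
  have h := hg.one_sub_normSq_apply (origin N)
  have h0 : (origin N).1 = 0 := rfl
  simp [confDeriv, h0] at h
  exact h.symm

/-! ### Discreteness -/

variable {G : Subgroup (ClosedUnitBall N ≃ₜ ClosedUnitBall N)}

theorem IsKleinian.confDeriv_mul (hG : IsKleinian G) (hg : g ∈ G) (hh : h ∈ G)
    (z : ClosedUnitBall N) : confDeriv (g * h) z = confDeriv g (h z) * confDeriv h z :=
  (hG.conformal g hg).confDeriv_mul (hG.conformal h hh) (hG.conformal _ (G.mul_mem hg hh)) z

theorem IsConformalAut.dist_apply_le (hg : IsConformalAut g) {δ : ℝ} (hδ : 0 < δ)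
    (hw : ‖(g.symm (origin N)).1‖ ≤ 1 - δ) (z w : ClosedUnitBall N) :
    dist (g z) (g w) ≤ (δ ^ 2)⁻¹ * dist z w := by
  have key : ∀ z, confDeriv g z ≤ (δ ^ 2)⁻¹ := fun z => by
    rw [confDeriv_eq, ← one_div]
    refine div_le_div₀ zero_le_one ?_ (by positivity) ?_
    · nlinarith [sq_nonneg ‖(g.symm (origin N)).1‖]
    · refine le_trans ?_ (sq_one_sub_norm_right_le z _)
      exact pow_le_pow_left₀ hδ.le (by linarith) 2
  rw [Subtype.dist_eq, Subtype.dist_eq, dist_eq_norm, dist_eq_norm]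
  refine (sq_le_sq₀ (norm_nonneg _) (by positivity)).1 ?_
  rw [hg.normSq_sub_apply, mul_pow, sq (δ ^ 2)⁻¹]
  have h1 := key z
  have h2 := key w
  have := (hg.confDeriv_pos w).le
  gcongr

/-- Proper discontinuity. The elements moving the centre by a bounded distance are uniformly
Lipschitz, so up to a small error each of them is determined by the cells of a finite cover into
which it maps the points of a finite net; discreteness makes this finite data injective. -/
theorem IsKleinian.finite_norm_symm_le (hG : IsKleinian G) {δ : ℝ} (hδ : 0 < δ) :
    {g : G | ‖((g : ClosedUnitBall N ≃ₜ ClosedUnitBall N).symm (origin N)).1‖ ≤ 1 - δ}.Finite := by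
  obtain ⟨ε, hε, hdisc⟩ := hG.discrete
  set L : ℝ := (δ ^ 2)⁻¹ with hL
  have hL0 : 0 < L := by positivity
  set η : ℝ := ε / (2 * (L + 1)) / 2 with hη
  have hη0 : 0 < η := by positivity
  obtain ⟨t, -, htfin, htcov⟩ :=
    (isCompact_univ (X := ClosedUnitBall N)).finite_cover_balls hη0
  have hnear : ∀ z : ClosedUnitBall N, ∃ x : t, dist z x < η := fun z => by
    have := htcov (mem_univ z)
    simp only [mem_iUnion, Metric.mem_ball] at this
    obtain ⟨x, hx, hzx⟩ := this
    exact ⟨⟨x, hx⟩, hzx⟩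
  choose cell hcell using hnear
  have : Finite t := htfin
  rw [← Set.finite_coe_iff]
  refine Finite.of_injective
    (f := fun (g : {g : G | ‖((g : ClosedUnitBall N ≃ₜ ClosedUnitBall N).symm
      (origin N)).1‖ ≤ 1 - δ}) (x : t) => cell (g.1.1 x.1)) ?_
  rintro ⟨⟨g, hgG⟩, hg⟩ ⟨⟨h, hhG⟩, hh⟩ heq
  have hclose : ∀ z, dist (g z) (h z) < ε := by
    intro z
    have h1 := (hG.conformal g hgG).dist_apply_le hδ hg z (cell z)
    have h2 := (hG.conformal h hhG).dist_apply_le hδ hh (cell z) z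
    have h3 : cell (g (cell z)) = cell (h (cell z)) := congrFun heq (cell z)
    have h4 := hcell (g (cell z))
    have h5 := hcell (h (cell z))
    have h6 := hcell z
    rw [← h3] at h5
    have h7 : dist (g (cell z)) (h (cell z)) < 2 * η := by
      have := dist_triangle_right (g (cell z)) (h (cell z)) (cell (g (cell z)))
      linarith
    have h8 := dist_triangle4 (g z) (g (cell z)) (h (cell z)) (h z)
    rw [dist_comm _ z] at h2
    have h9 : L * dist z (cell z) ≤ L * η := by gcongr
    have h10 : 4 * ((L + 1) * η) = ε := by
      rw [hη]
      field_simp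
      ring
    have h11 : 0 < η := hη0
    nlinarith
  have h1 : g * h⁻¹ = 1 := by
    refine hdisc _ (G.mul_mem hgG (G.inv_mem hhG)) fun z => ?_
    have := hclose (h.symm z)
    rwa [h.apply_symm_apply] at this
  have h2 : g = h := mul_inv_eq_one.1 h1
  subst h2
  rfl

theorem IsKleinian.countable (hG : IsKleinian G) : Countable G := by
  have hcov : (⋃ n : ℕ, {g : G | ‖((g : ClosedUnitBall N ≃ₜ ClosedUnitBall N).symm
      (origin N)).1‖ ≤ 1 - 1 / ((n : ℝ) + 1)}) = univ := by
    refine eq_univ_of_forall fun g => mem_iUnion.2 ?_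
    have hw : ‖((g : ClosedUnitBall N ≃ₜ ClosedUnitBall N).symm (origin N)).1‖ < 1 :=
      (hG.conformal g g.2).symm_origin_mem
    obtain ⟨n, hn⟩ := exists_nat_one_div_lt (sub_pos.2 hw)
    exact ⟨n, by rw [mem_ofPred_eq]; linarith⟩
  rw [← Set.countable_univ_iff, ← hcov]
  exact countable_iUnion fun n =>
    (hG.finite_norm_symm_le (δ := 1 / ((n : ℝ) + 1)) (by positivity)).countable

/-- A conformal automorphism which fixes all points of a ball is trivial: comparing the conformal
derivative `1` at three collinear points of the ball shows that the origin is fixed, so the map is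
a Euclidean isometry fixing the origin, and it preserves the inner products with all vectors of
the ball. -/
theorem IsConformalAut.eq_one_of_fixes_ball (hg : IsConformalAut g)
    {a : ClosedUnitBall N} {r : ℝ} (hr : 0 < r)
    (hfix : ∀ b : ClosedUnitBall N, ‖b.1 - a.1‖ < r → b ∈ hypSpace N ∧ g b = b) : g = 1 := by
  obtain ⟨ha, hga⟩ := hfix a (by simpa using hr)
  have ha1 : ‖a.1‖ < 1 := ha
  have hpt : ∀ v : EuclideanSpace ℝ (Fin (N + 1)), ∃ t : ℝ, 0 < t ∧ ∀ s : ℝ, |s| ≤ t →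
      ∃ b : ClosedUnitBall N, b.1 = a.1 + s • v ∧ b ∈ hypSpace N ∧ g b = b := by
    intro v
    have hm : 0 < min r (1 - ‖a.1‖) := lt_min hr (by linarith)
    refine ⟨min r (1 - ‖a.1‖) / (2 * (‖v‖ + 1)), by positivity, fun s hs => ?_⟩
    have hv : ‖s • v‖ < min r (1 - ‖a.1‖) := by
      rw [norm_smul, Real.norm_eq_abs]
      rw [le_div_iff₀ (by positivity)] at hs
      nlinarith [norm_nonneg v, abs_nonneg s]
    have hb : ‖a.1 + s • v‖ ≤ 1 := by
      have := norm_add_le a.1 (s • v)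
      have := min_le_right r (1 - ‖a.1‖)
      linarith
    refine ⟨⟨a.1 + s • v, mem_closedBall_zero_iff.2 hb⟩, rfl, hfix _ ?_⟩
    simpa using lt_of_lt_of_le hv (min_le_left _ _)
  have hj : ∀ b : ClosedUnitBall N, b ∈ hypSpace N → g b = b → confDeriv g b = 1 := by
    intro b hb hgb
    have h1 := hg.one_sub_normSq_apply b
    rw [hgb] at h1
    have := one_sub_normSq_pos hb
    exact mul_right_cancel₀ this.ne' (by linarith)
  set w := g.symm (origin N) with hw
  have hw0 : w.1 = 0 := by
    obtain ⟨t, ht, hb⟩ := hpt w.1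
    have key : ∀ b : ClosedUnitBall N, b ∈ hypSpace N → g b = b →
        1 - ‖w.1‖ ^ 2 = 1 - 2 * ⟪b.1, w.1⟫ + ‖b.1‖ ^ 2 * ‖w.1‖ ^ 2 := by
      intro b hb hgb
      have h1 := hj b hb hgb
      rwa [confDeriv_eq, ← hw, div_eq_one_iff_eq (confDen_pos b hg.symm_origin_mem).ne'] at h1
    obtain ⟨b, hb1, hb2, hb3⟩ := hb t (abs_of_pos ht).le
    obtain ⟨c, hc1, hc2, hc3⟩ := hb (-t) (by rw [abs_neg, abs_of_pos ht])
    have k0 := key a ha hga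
    have k1 := key b hb2 hb3
    have k2 := key c hc2 hc3
    rw [hb1, norm_add_sq_real, inner_add_left, inner_smul_left, inner_smul_right, norm_smul,
      mul_pow, Real.norm_eq_abs, sq_abs, real_inner_self_eq_norm_sq] at k1
    rw [hc1, norm_add_sq_real, inner_add_left, inner_smul_left, inner_smul_right, norm_smul,
      mul_pow, Real.norm_eq_abs, sq_abs, real_inner_self_eq_norm_sq] at k2
    simp only [conj_trivial] at k1 k2
    -- The second difference of the quadratic function `key` along the direction `w` vanishes.
    have h4 : (t * ‖w.1‖ ^ 2) ^ 2 = 0 := by linear_combination k0 - (k1 + k2) / 2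
    have h5 : t * ‖w.1‖ ^ 2 = 0 := by simpa using h4
    simpa [ht.ne'] using h5
  have hj1 : ∀ z, confDeriv g z = 1 := by
    intro z
    rw [confDeriv_eq, ← hw, confDen, hw0]
    simp
  have hiso : ∀ z w, ‖(g z).1 - (g w).1‖ ^ 2 = ‖z.1 - w.1‖ ^ 2 := by
    intro z w
    rw [hg.normSq_sub_apply, hj1, hj1]
    ring
  -- `g z - z` is orthogonal to the ball, in particular to a multiple of itself.
  ext1 z
  change g z = z
  obtain ⟨t, ht, hb⟩ := hpt ((g z).1 - z.1)
  obtain ⟨b, hb1, hb2, hb3⟩ := hb t (abs_of_pos ht).le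
  have k1 := hiso z a
  have k2 := hiso z b
  have k3 := hg.one_sub_normSq_apply z
  rw [hj1] at k3
  rw [hga] at k1
  rw [hb3, norm_sub_sq_real, norm_sub_sq_real z.1, hb1, inner_add_right, inner_add_right,
    inner_smul_right, inner_smul_right] at k2
  rw [norm_sub_sq_real, norm_sub_sq_real z.1] at k1
  have k4 : t * ⟪(g z).1 - z.1, (g z).1 - z.1⟫ = 0 := by
    rw [inner_sub_left]
    linear_combination (k1 - k2) / 2
  have k5 := (mul_eq_zero.1 k4).resolve_left ht.ne'
  exact Subtype.ext (sub_eq_zero.1 (inner_self_eq_zero.1 k5))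

theorem IsKleinian.exists_trivial_stabilizer (hG : IsKleinian G) :
    ∃ a ∈ hypSpace N, ∀ g ∈ G, g a = a → g = 1 := by
  have := hG.countable
  have hopen : IsOpen (hypSpace N) := by
    have : Continuous fun z : ClosedUnitBall N => ‖z.1‖ := by fun_prop
    exact isOpen_lt this continuous_const
  have hfixed : ∀ g : {g : G // g ≠ 1}, IsClosed {z : ClosedUnitBall N | g.1.1 z = z} :=
    fun g => isClosed_eq g.1.1.continuous continuous_id
  have hdense : Dense (⋂ g : {g : G // g ≠ 1}, {z : ClosedUnitBall N | g.1.1 z = z}ᶜ) := by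
    refine dense_iInter_of_isOpen (fun g => (hfixed g).isOpen_compl) fun g => ?_
    rw [← interior_eq_empty_iff_dense_compl]
    by_contra hne
    obtain ⟨a, ha1, ha2⟩ := dense_hypSpace.inter_open_nonempty _ isOpen_interior
      (nonempty_iff_ne_empty.2 hne)
    have hnhds : {z : ClosedUnitBall N | g.1.1 z = z} ∩ hypSpace N ∈ 𝓝 a :=
      inter_mem (mem_interior_iff_mem_nhds.1 ha1) (hopen.mem_nhds ha2)
    obtain ⟨r, hr, hball⟩ := Metric.mem_nhds_iff.1 hnhds
    refine g.2 (Subtype.ext ((hG.conformal g.1.1 g.1.2).eq_one_of_fixes_ball (a := a) hr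
      fun b hb => ?_))
    have hb' : b ∈ Metric.ball a r := by
      rwa [Metric.mem_ball, Subtype.dist_eq, dist_eq_norm]
    exact ⟨(hball hb').2, (hball hb').1⟩
  obtain ⟨a, ha1, ha2⟩ := hdense.inter_open_nonempty _ hopen ⟨_, origin_mem_hypSpace⟩
  refine ⟨a, ha1, fun g hg hga => ?_⟩
  by_contra hne
  exact mem_iInter.1 ha2 ⟨⟨g, hg⟩, fun h => hne (congrArg Subtype.val h)⟩ hga

/-! ### Boundary points outside the big horospherical limit set -/

theorem IsKleinian.apply_mem_hypSpace (hG : IsKleinian G) (hg : g ∈ G) {z : ClosedUnitBall N}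
    (hz : z ∈ hypSpace N) : g z ∈ hypSpace N :=
  ((hG.conformal g hg).mem_hypSpace_iff z).2 hz

theorem IsKleinian.apply_mem_bdSphere (hG : IsKleinian G) (hg : g ∈ G) {z : ClosedUnitBall N}
    (hz : z ∈ bdSphere N) : g z ∈ bdSphere N :=
  mem_bdSphere_of_notMem fun h =>
    ne_of_mem_hypSpace (((hG.conformal g hg).mem_hypSpace_iff z).1 h) hz rfl

/-- At a boundary point outside the big horospherical limit set every horoball contains the
images of the origin under only finitely many group elements. -/
theorem IsKleinian.finite_invPoisson_origin_le (hG : IsKleinian G) {ζ : ClosedUnitBall N}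
    (hζ : ζ ∈ bdSphere N) (hH : ζ ∉ bigHorosphericalLimitSet G) {c : ℝ} (hc : 0 < c) :
    {g : G | invPoisson (g.1 (origin N)) ζ ≤ c}.Finite := by
  by_contra hinf
  apply hH
  have hacc : AccPt ζ (𝓟 (orbit G (origin N) ∩ horoball ζ (1 / (2 * c)))) := by
    rw [accPt_iff_nhds]
    intro U hU
    obtain ⟨ε, hε, hball⟩ := Metric.mem_nhds_iff.1 hU
    have hδ : 0 < ε ^ 2 / (2 * c) := by positivity
    -- All but finitely many orbit points of the horoball are so close to the sphere that they lie
    -- within `ε` of `ζ`.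
    obtain ⟨g, hg1, hg2⟩ := (Set.Infinite.sdiff hinf (hG.finite_norm_symm_le hδ)).nonempty
    have hg2 : ¬ ‖(g.1.symm (origin N)).1‖ ≤ 1 - ε ^ 2 / (2 * c) := hg2
    have hg1 : invPoisson (g.1 (origin N)) ζ ≤ c := hg1
    have hmem := hG.apply_mem_hypSpace g.2 origin_mem_hypSpace
    have hpos := one_sub_normSq_pos hmem
    have hsub := normSq_sub_pos hmem hζ
    rw [(hG.conformal _ g.2).norm_symm_origin, not_le] at hg2
    rw [invPoisson, div_le_iff₀ hpos] at hg1
    refine ⟨g.1 (origin N), ⟨hball ?_, ⟨g.1, g.2, rfl⟩, hmem, ?_⟩,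
      (ne_of_mem_hypSpace hmem hζ).symm⟩
    · rw [Metric.mem_ball', Subtype.dist_eq, dist_eq_norm]
      refine (sq_lt_sq₀ (norm_nonneg _) hε.le).1 (lt_of_le_of_lt hg1 ?_)
      have h1 : c * (ε ^ 2 / (2 * c)) = ε ^ 2 / 2 := by field_simp
      have h2 : c * (1 - ‖(g.1 (origin N)).1‖) < ε ^ 2 / 2 := by
        rw [← h1]
        gcongr
        linarith
      have h3 := norm_le_one (g.1 (origin N))
      nlinarith [mul_nonneg hc.le (sq_nonneg (1 - ‖(g.1 (origin N)).1‖))]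
    · rw [poissonKernel, div_lt_div_iff₀ (by positivity) hsub]
      nlinarith
  refine ⟨⟨?_, ?_⟩, 1 / (2 * c), by positivity, hacc⟩
  · exact closure_mono inter_subset_left (mem_closure_iff_clusterPt.2 hacc.clusterPt)
  · rintro ⟨g, hg, rfl⟩
    exact ne_of_mem_hypSpace (hG.apply_mem_hypSpace hg origin_mem_hypSpace) hζ rfl

/-- Moving the base point of an orbit changes the horoballs containing its points by a bounded
factor only. -/
theorem IsKleinian.invPoisson_origin_le (hG : IsKleinian G) (hg : g ∈ G) {a ζ : ClosedUnitBall N}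
    (ha : a ∈ hypSpace N) (hζ : ζ ∈ bdSphere N) :
    invPoisson (g (origin N)) ζ ≤ (1 - ‖a.1‖ ^ 2) / (1 - ‖a.1‖) ^ 2 * invPoisson (g a) ζ := by
  have hg' := hG.conformal g hg
  have hξ : g.symm ζ ∈ bdSphere N := hG.apply_mem_bdSphere (G.inv_mem hg) hζ
  rw [← g.apply_symm_apply ζ, hg'.invPoisson_apply, hg'.invPoisson_apply]
  set ξ := g.symm ζ
  have hξ1 : ‖ξ.1‖ = 1 := hξ
  have hj := hg'.confDeriv_pos ξ
  have h0 : (origin N).1 = 0 := rfl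
  have ha1 : 0 < 1 - ‖a.1‖ := sub_pos.2 ha
  have ha2 := one_sub_normSq_pos ha
  have h1 : (1 - ‖a.1‖) ^ 2 ≤ ‖ξ.1 - a.1‖ ^ 2 := by
    have := norm_sub_norm_le ξ.1 a.1
    rw [hξ1] at this
    gcongr
  rw [mul_left_comm]
  gcongr
  simp only [invPoisson, h0, sub_zero, hξ1, norm_zero]
  have h2 : (1 - ‖a.1‖ ^ 2) / (1 - ‖a.1‖) ^ 2 * (‖ξ.1 - a.1‖ ^ 2 / (1 - ‖a.1‖ ^ 2)) =
      ‖ξ.1 - a.1‖ ^ 2 / (1 - ‖a.1‖) ^ 2 := by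
    field_simp
  rw [h2]
  norm_num
  rwa [one_le_div (by positivity)]

theorem IsKleinian.finite_invPoisson_le (hG : IsKleinian G) {a ζ : ClosedUnitBall N}
    (ha : a ∈ hypSpace N) (hζ : ζ ∈ bdSphere N) (hH : ζ ∉ bigHorosphericalLimitSet G) {c : ℝ}
    (hc : 0 < c) : {g : G | invPoisson (g.1 a) ζ ≤ c}.Finite := by
  have ha1 : 0 < 1 - ‖a.1‖ := sub_pos.2 ha
  have ha2 := one_sub_normSq_pos ha
  refine (hG.finite_invPoisson_origin_le hζ hH
    (c := (1 - ‖a.1‖ ^ 2) / (1 - ‖a.1‖) ^ 2 * c) (by positivity)).subset fun g hg => ?_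
  have hg : invPoisson (g.1 a) ζ ≤ c := hg
  refine (hG.invPoisson_origin_le g.2 ha hζ).trans ?_
  gcongr

/-- The boundary at infinity of the closed Dirichlet domain centred at `a`: the boundary points
from which no point of the orbit of `a` looks closer than `a`, measured by horoballs. -/
def dirichletBoundary (G : Subgroup (ClosedUnitBall N ≃ₜ ClosedUnitBall N))
    (a : ClosedUnitBall N) : Set (ClosedUnitBall N) :=
  {ζ | ζ ∈ bdSphere N ∧ ∀ g ∈ G, invPoisson a ζ ≤ invPoisson (g a) ζ}

theorem isClosed_dirichletBoundary (a : ClosedUnitBall N) : IsClosed (dirichletBoundary G a) := by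
  have h1 : IsClosed (bdSphere N) := by
    have : Continuous fun z : ClosedUnitBall N => ‖z.1‖ := by fun_prop
    exact isClosed_eq this continuous_const
  have h2 : dirichletBoundary G a =
      bdSphere N ∩ ⋂ g ∈ G, {ζ | invPoisson a ζ ≤ invPoisson (g a) ζ} := by
    ext ζ
    simp [dirichletBoundary]
  rw [h2]
  exact h1.inter (isClosed_biInter fun g _ =>
    isClosed_le (continuous_invPoisson _) (continuous_invPoisson _))

theorem IsKleinian.symm_mem_dirichletBoundary_iff (hG : IsKleinian G) (hg : g ∈ G)
    {a ζ : ClosedUnitBall N} (hζ : ζ ∈ bdSphere N) :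
    g.symm ζ ∈ dirichletBoundary G a ↔ ∀ h ∈ G, invPoisson (g a) ζ ≤ invPoisson (h a) ζ := by
  have hg' := hG.conformal g hg
  have hξ : g.symm ζ ∈ bdSphere N := hG.apply_mem_bdSphere (G.inv_mem hg) hζ
  have key : ∀ b, invPoisson (g b) ζ = confDeriv g (g.symm ζ) * invPoisson b (g.symm ζ) :=
    fun b => by rw [← hg'.invPoisson_apply, g.apply_symm_apply]
  have hj := hg'.confDeriv_pos (g.symm ζ)
  constructor
  · rintro ⟨-, h⟩ k hk
    have h1 : g (g.symm (k a)) = k a := g.apply_symm_apply _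
    rw [← h1, key, key]
    exact mul_le_mul_of_nonneg_left (h (g⁻¹ * k) (G.mul_mem (G.inv_mem hg) hk)) hj.le
  · refine fun h => ⟨hξ, fun k hk => ?_⟩
    have := h (g * k) (G.mul_mem hg hk)
    change invPoisson (g a) ζ ≤ invPoisson (g (k a)) ζ at this
    rw [key, key] at this
    exact le_of_mul_le_mul_left this hj

/-- Every boundary point outside the big horospherical limit set lies in at least one and at most
finitely many translates of the boundary at infinity of a Dirichlet domain. -/
theorem IsKleinian.dirichletBoundary_translates (hG : IsKleinian G) {a ζ : ClosedUnitBall N}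
    (ha : a ∈ hypSpace N) (hζ : ζ ∈ bdSphere N) (hH : ζ ∉ bigHorosphericalLimitSet G) :
    {g : G | g.1.symm ζ ∈ dirichletBoundary G a}.Nonempty ∧
      {g : G | g.1.symm ζ ∈ dirichletBoundary G a}.Finite := by
  have hfin := hG.finite_invPoisson_le ha hζ hH (invPoisson_pos ha hζ)
  constructor
  · obtain ⟨g, hg, hmin⟩ := Set.exists_min_image _ (fun g : G => invPoisson (g.1 a) ζ) hfin
      ⟨1, le_refl (invPoisson a ζ)⟩
    refine ⟨g, (hG.symm_mem_dirichletBoundary_iff g.2 hζ).2 fun h hh => ?_⟩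
    by_cases hle : invPoisson (h a) ζ ≤ invPoisson a ζ
    · exact hmin ⟨h, hh⟩ hle
    · exact le_trans hg (not_le.1 hle).le
  · exact hfin.subset fun g hg =>
      (hG.symm_mem_dirichletBoundary_iff g.2 hζ).1 hg 1 G.one_mem

/-! ### Convergence of the Poincaré series at a boundary point -/

theorem IsKleinian.continuous_weight (hG : IsKleinian G) (s : ℝ) (hg : g ∈ G) :
    Continuous fun z => confDeriv g z ^ s :=
  (hG.conformal g hg).continuous_confDeriv.rpow_const fun z =>
    Or.inl ((hG.conformal g hg).confDeriv_pos z).ne'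

/-- The multiplicity with which the translates of `D` cover the point `x`. -/
def coverMultiplicity (G : Subgroup (ClosedUnitBall N ≃ₜ ClosedUnitBall N))
    (D : Set (ClosedUnitBall N)) (x : ClosedUnitBall N) : ENNReal :=
  ∑' g : G, D.indicator 1 (g.1.symm x)

theorem coverMultiplicity_symm (D : Set (ClosedUnitBall N)) (hg : g ∈ G) (x : ClosedUnitBall N) :
    coverMultiplicity G D (g.symm x) = coverMultiplicity G D x :=
  (Equiv.mulLeft (⟨g, hg⟩ : G)).tsum_eq fun k : G => D.indicator 1 (k.1.symm x)

theorem measurable_coverMultiplicity [Countable G] {D : Set (ClosedUnitBall N)}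
    (hD : MeasurableSet D) : Measurable (coverMultiplicity G D) :=
  Measurable.tsum fun g =>
    (measurable_one.indicator hD).comp g.1.symm.continuous.measurable

theorem coverMultiplicity_ne_top {D : Set (ClosedUnitBall N)} {x : ClosedUnitBall N}
    (h : {g : G | g.1.symm x ∈ D}.Finite) : coverMultiplicity G D x ≠ ⊤ := by
  rw [coverMultiplicity, tsum_eq_sum (s := h.toFinset)]
  · exact ENNReal.sum_ne_top.2 fun g _ => by
      by_cases hx : g.1.symm x ∈ D <;> simp [hx]
  · intro g hg
    have : g.1.symm x ∉ D := by simpa using hg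
    simp [this]

/-- If a set of positive conformal measure is covered with bounded multiplicity by its translates,
then the Poincaré series converges almost everywhere on it: its integral over the set is the sum
of the measures of the translates. -/
theorem IsKleinian.exists_poincareSeries_lt_top (hG : IsKleinian G) {s : ℝ}
    {μ : Measure (ClosedUnitBall N)} (hμ : IsConformalMeasure G s μ) {E : Set (ClosedUnitBall N)}
    (hE : MeasurableSet E) (hpos : μ E ≠ 0) (m : ℕ)
    (hm : ∀ x ∈ E, coverMultiplicity G E x ≤ m) : ∃ ζ ∈ E, poincareSeries G ζ s < ⊤ := by
  have := hG.countable
  have := hμ.prob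
  have hmeas : ∀ g : G, Measurable fun z => ENNReal.ofReal (confDeriv g.1 z ^ s) :=
    fun g => (hG.continuous_weight s g.2).measurable.ennreal_ofReal
  -- The bound extends from `E` to all points, as the multiplicity is constant on orbits and
  -- vanishes outside the translates of `E`.
  have hbound : ∀ x, coverMultiplicity G E x ≤ m := by
    intro x
    by_cases hx : ∃ g : G, g.1.symm x ∈ E
    · obtain ⟨g, hg⟩ := hx
      rw [← coverMultiplicity_symm E g.2]
      exact hm _ hg
    · have : coverMultiplicity G E x = 0 := by
        rw [coverMultiplicity, ENNReal.tsum_eq_zero]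
        exact fun g => indicator_of_notMem (fun h => hx ⟨g, h⟩) _
      rw [this]
      exact zero_le
  have hint : ∫⁻ z in E, poincareSeries G z s ∂μ ≤ m := by
    calc ∫⁻ z in E, poincareSeries G z s ∂μ
        = ∑' g : G, ∫⁻ z in E, ENNReal.ofReal (confDeriv g.1 z ^ s) ∂μ :=
          lintegral_tsum fun g => (hmeas g).aemeasurable
      _ = ∑' g : G, ∫⁻ x, E.indicator 1 (g.1.symm x) ∂μ := by
          congr 1
          ext g
          rw [← hμ.conformal g.1 g.2 E hE]
          have h1 : MeasurableSet (g.1 '' E) := by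
            rw [Homeomorph.image_eq_preimage_symm]
            exact g.1.symm.continuous.measurable hE
          rw [← lintegral_indicator_one h1]
          congr 1
          ext x
          rw [Homeomorph.image_eq_preimage_symm]
          rfl
      _ = ∫⁻ x, coverMultiplicity G E x ∂μ :=
          (lintegral_tsum fun g : G => ((measurable_one.indicator hE).comp
            g.1.symm.continuous.measurable).aemeasurable).symm
      _ ≤ ∫⁻ _, (m : ENNReal) ∂μ := lintegral_mono hbound
      _ = m := by simp
  have hae := ae_lt_top' (Measurable.tsum hmeas).aemeasurable
    (ne_top_of_le_ne_top (ENNReal.natCast_ne_top m) hint)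
  rw [ae_restrict_iff' hE] at hae
  by_contra! hcon
  refine hpos (measure_mono_null (fun z hz => ?_) (ae_iff.1 hae))
  exact fun h => absurd (h hz) (not_lt.2 (hcon z hz))

/-- A conformal measure charging the complement of the big horospherical limit set provides
a boundary point of the closed Dirichlet domain at which the Poincaré series converges. -/
theorem IsKleinian.exists_mem_dirichletBoundary (hG : IsKleinian G) {s : ℝ}
    {A : Set (ClosedUnitBall N)} (hAS : A ⊆ bdSphere N) (hA : MeasurableSet A)
    (hinv : ∀ g ∈ G, g '' A = A) {μ : Measure (ClosedUnitBall N)}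
    (hμ : IsConformalMeasure G s μ) (hpos : 0 < μ (A \ bigHorosphericalLimitSet G))
    {a : ClosedUnitBall N} (ha : a ∈ hypSpace N) :
    ∃ ζ ∈ A, ζ ∈ dirichletBoundary G a ∧ poincareSeries G ζ s < ⊤ := by
  have := hG.countable
  have hD : MeasurableSet (dirichletBoundary G a) := (isClosed_dirichletBoundary a).measurableSet
  set D := dirichletBoundary G a
  set E : ℕ → Set (ClosedUnitBall N) := fun m => A ∩ D ∩ {x | coverMultiplicity G D x ≤ m}
  have hE : ∀ m, MeasurableSet (E m) := fun m =>
    (hA.inter hD).inter (measurableSet_le (measurable_coverMultiplicity hD) measurable_const)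
  have hex : ∃ m, μ (E m) ≠ 0 := by
    by_contra! hzero
    refine hpos.ne' (measure_mono_null (t := ⋃ m, ⋃ g : G, g.1 '' E m) ?_ ?_)
    · rintro ζ ⟨hζA, hζH⟩
      obtain ⟨⟨g, hg⟩, hfin⟩ := hG.dirichletBoundary_translates ha (hAS hζA) hζH
      obtain ⟨m, hm⟩ := ENNReal.exists_nat_gt (coverMultiplicity_ne_top hfin)
      refine mem_iUnion₂.2 ⟨m, g, g.1.symm ζ, ⟨⟨?_, hg⟩, ?_⟩, g.1.apply_symm_apply ζ⟩
      · have := hinv g.1 g.2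
        rw [← this] at hζA
        obtain ⟨ξ, hξ, rfl⟩ := hζA
        rwa [g.1.symm_apply_apply]
      · change coverMultiplicity G D (g.1.symm ζ) ≤ m
        rw [coverMultiplicity_symm D g.2]
        exact hm.le
    · refine measure_iUnion_null fun m => measure_iUnion_null fun g => ?_
      rw [hμ.conformal g.1 g.2 _ (hE m), Measure.restrict_eq_zero.2 (hzero m),
        lintegral_zero_measure]
  obtain ⟨m, hm⟩ := hex
  obtain ⟨ζ, hζ, hP⟩ := hG.exists_poincareSeries_lt_top hμ (hE m) hm m fun x hx => by
    refine le_trans (ENNReal.tsum_le_tsum fun g => ?_) hx.2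
    exact indicator_le_indicator_of_subset (fun y hy => hy.1.2) (fun _ => zero_le) _
  exact ⟨ζ, hζ.1.1, hζ.1.2, hP⟩

/-! ### Hyperboloid coordinates and geodesic rays -/

/-- The time coordinate of a point of the ball in the hyperboloid model. -/
def timeCoord (z : ClosedUnitBall N) : ℝ := (1 + ‖z.1‖ ^ 2) / (1 - ‖z.1‖ ^ 2)

/-- The space coordinates of a point of the ball in the hyperboloid model. -/
def spaceCoord (z : ClosedUnitBall N) : EuclideanSpace ℝ (Fin (N + 1)) :=
  (2 / (1 - ‖z.1‖ ^ 2)) • z.1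

theorem coshDist_eq_lorentz {z w : ClosedUnitBall N} (hz : z ∈ hypSpace N) (hw : w ∈ hypSpace N) :
    coshDist z w = timeCoord z * timeCoord w - ⟪spaceCoord z, spaceCoord w⟫ := by
  have h1 := one_sub_normSq_pos hz
  have h2 := one_sub_normSq_pos hw
  rw [coshDist, timeCoord, timeCoord, spaceCoord, spaceCoord, inner_smul_left, inner_smul_right,
    norm_sub_sq_real, conj_trivial]
  field_simp
  ring

theorem invPoisson_eq_lorentz {z ζ : ClosedUnitBall N} (hζ : ζ ∈ bdSphere N) :
    invPoisson z ζ = timeCoord z - ⟪spaceCoord z, ζ.1⟫ := by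
  have h2 : ‖ζ.1‖ = 1 := hζ
  rw [invPoisson, timeCoord, spaceCoord, inner_smul_left, norm_sub_sq_real, h2, conj_trivial,
    real_inner_comm]
  ring

theorem timeCoord_sq {z : ClosedUnitBall N} (hz : z ∈ hypSpace N) :
    timeCoord z ^ 2 = ‖spaceCoord z‖ ^ 2 + 1 := by
  have h := coshDist_eq_lorentz hz hz
  rw [coshDist_self, real_inner_self_eq_norm_sq] at h
  linear_combination -h

theorem timeCoord_pos {z : ClosedUnitBall N} (hz : z ∈ hypSpace N) : 0 < timeCoord z :=
  div_pos (by positivity) (one_sub_normSq_pos hz)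

theorem norm_spaceCoord_lt {z : ClosedUnitBall N} (hz : z ∈ hypSpace N) :
    ‖spaceCoord z‖ < timeCoord z := by
  have h1 := timeCoord_sq hz
  have h2 := timeCoord_pos hz
  nlinarith [norm_nonneg (spaceCoord z)]

theorem one_add_timeCoord {z : ClosedUnitBall N} (hz : z ∈ hypSpace N) :
    1 + timeCoord z = 2 / (1 - ‖z.1‖ ^ 2) := by
  have h1 := one_sub_normSq_pos hz
  rw [timeCoord]
  field_simp
  ring

/-- Every point of the upper sheet of the hyperboloid comes from a point of the ball. -/
theorem exists_of_hyperboloid {t : ℝ} {x : EuclideanSpace ℝ (Fin (N + 1))} (ht : 0 < t)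
    (h : t ^ 2 = ‖x‖ ^ 2 + 1) :
    ∃ z ∈ hypSpace N, z.1 = (1 + t)⁻¹ • x ∧ timeCoord z = t ∧ spaceCoord z = x := by
  have hn : ‖(1 + t)⁻¹ • x‖ ^ 2 = (t - 1) / (1 + t) := by
    rw [norm_smul, mul_pow, norm_inv, Real.norm_of_nonneg (by positivity : 0 ≤ 1 + t)]
    have : ‖x‖ ^ 2 = (t - 1) * (1 + t) := by linear_combination -h
    rw [this]
    field_simp
  have h1 : 1 - ‖(1 + t)⁻¹ • x‖ ^ 2 = 2 / (1 + t) := by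
    rw [hn]
    field_simp
    ring
  have hpos : 0 < 1 - ‖(1 + t)⁻¹ • x‖ ^ 2 := by
    rw [h1]
    positivity
  have hlt : ‖(1 + t)⁻¹ • x‖ < 1 := by nlinarith [norm_nonneg ((1 + t)⁻¹ • x)]
  refine ⟨⟨(1 + t)⁻¹ • x, mem_closedBall_zero_iff.2 hlt.le⟩, hlt, rfl, ?_, ?_⟩
  · rw [timeCoord, h1, hn]
    field_simp
    ring
  · rw [spaceCoord, h1, smul_smul]
    have : 2 / (2 / (1 + t)) * (1 + t)⁻¹ = 1 := by field_simp
    rw [this, one_smul]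

/-- The geodesic ray from `a` to `ζ`, given in hyperboloid coordinates by `exp (-t) a + sinh t u`,
where `u` is the lightlike vector over `ζ` of Lorentz product `-1` with `a`. Distances from its
points are affine in the reciprocal Poisson kernel, and it approaches `ζ` nontangentially. -/
theorem exists_geodesicRay {a ζ : ClosedUnitBall N} (ha : a ∈ hypSpace N) (hζ : ζ ∈ bdSphere N) :
    ∃ γ : ℝ → ClosedUnitBall N, IsGeodesicRay γ ζ ∧
      (∀ t, 0 ≤ t → ∀ b ∈ hypSpace N, coshDist (γ t) b =
        Real.exp (-t) * coshDist a b + Real.sinh t * (invPoisson b ζ / invPoisson a ζ)) ∧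
      ∃ C, 0 ≤ C ∧ ∀ t, 0 ≤ t → ‖ζ.1 - (γ t).1‖ ≤ C * (1 - ‖(γ t).1‖ ^ 2) := by
  have hip := invPoisson_pos ha hζ
  have hlor := invPoisson_eq_lorentz (z := a) hζ
  have hτ := timeCoord_pos ha
  have hζ1 : ‖ζ.1‖ = 1 := hζ
  set u := (invPoisson a ζ)⁻¹ with hu
  have hu0 : 0 < u := inv_pos.2 hip
  have hui : u * invPoisson a ζ = 1 := inv_mul_cancel₀ hip.ne'
  have hsinh : ∀ t : ℝ, Real.sinh t = (Real.exp t - Real.exp (-t)) / 2 := Real.sinh_eq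
  have hexp : ∀ t : ℝ, Real.exp (-t) * Real.exp t = 1 := fun t => by
    rw [← Real.exp_add, neg_add_cancel, Real.exp_zero]
  have hex : ∀ t : ℝ, ∃ z : ClosedUnitBall N, 0 ≤ t → z ∈ hypSpace N ∧
      z.1 = (1 + (Real.exp (-t) * timeCoord a + Real.sinh t * u))⁻¹ •
        (Real.exp (-t) • spaceCoord a + (Real.sinh t * u) • ζ.1) ∧
      timeCoord z = Real.exp (-t) * timeCoord a + Real.sinh t * u ∧
      spaceCoord z = Real.exp (-t) • spaceCoord a + (Real.sinh t * u) • ζ.1 := by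
    intro t
    by_cases ht : 0 ≤ t
    · have hs : 0 ≤ Real.sinh t := Real.sinh_nonneg_iff.2 ht
      obtain ⟨z, hz⟩ := exists_of_hyperboloid
        (t := Real.exp (-t) * timeCoord a + Real.sinh t * u)
        (x := Real.exp (-t) • spaceCoord a + (Real.sinh t * u) • ζ.1) (by positivity) (by
          rw [norm_add_sq_real, norm_smul, norm_smul, inner_smul_left, inner_smul_right, mul_pow,
            mul_pow, Real.norm_eq_abs, sq_abs, Real.norm_eq_abs, sq_abs, hζ1, conj_trivial]
          have h1 := timeCoord_sq ha
          have h2 := hexp t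
          rw [hlor] at hui
          rw [hsinh t]
          linear_combination Real.exp (-t) ^ 2 * h1 +
            Real.exp (-t) * (Real.exp t - Real.exp (-t)) * hui + h2)
      exact ⟨z, fun _ => hz⟩
    · exact ⟨a, fun h => absurd h ht⟩
  choose γ hγ using hex
  have hdist : ∀ t, 0 ≤ t → ∀ b ∈ hypSpace N, coshDist (γ t) b =
      Real.exp (-t) * coshDist a b + Real.sinh t * (invPoisson b ζ / invPoisson a ζ) := by
    intro t ht b hb
    obtain ⟨h1, -, h3, h4⟩ := hγ t ht
    rw [coshDist_eq_lorentz h1 hb, h3, h4, coshDist_eq_lorentz ha hb, invPoisson_eq_lorentz hζ,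
      inner_add_left, inner_smul_left, inner_smul_left, div_eq_mul_inv _ (invPoisson a ζ), ← hu,
      conj_trivial, conj_trivial, real_inner_comm ζ.1]
    ring
  have hip_ray : ∀ t, 0 ≤ t → invPoisson (γ t) ζ = Real.exp (-t) * invPoisson a ζ := by
    intro t ht
    obtain ⟨h1, -, h3, h4⟩ := hγ t ht
    rw [invPoisson_eq_lorentz hζ, h3, h4, hlor, inner_add_left, inner_smul_left, inner_smul_left,
      real_inner_self_eq_norm_sq, hζ1, conj_trivial, conj_trivial]
    ring
  refine ⟨γ, ⟨fun t ht => (hγ t ht).1, fun t ht v hv => ?_, ?_⟩, hdist, ?_⟩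
  · apply hypDist_eq_abs
    rw [hdist t ht _ (hγ v hv).1, hip_ray v hv, coshDist_comm a, hdist v hv a ha, coshDist_self,
      div_self hip.ne', mul_div_cancel_right₀ _ hip.ne', Real.cosh_sub, Real.cosh_eq t,
      Real.cosh_eq v, hsinh, hsinh]
    ring
  · rw [tendsto_subtype_rng, tendsto_iff_norm_sub_tendsto_zero]
    have hlim : Tendsto (fun t : ℝ => Real.sqrt (Real.exp (-t) * invPoisson a ζ)) atTop (𝓝 0) := by
      have h1 : Tendsto (fun t : ℝ => Real.exp (-t) * invPoisson a ζ) atTop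
          (𝓝 (0 * invPoisson a ζ)) :=
        (Real.tendsto_exp_atBot.comp tendsto_neg_atTop_atBot).mul_const _
      rw [zero_mul] at h1
      simpa using h1.sqrt
    refine squeeze_zero' (Eventually.of_forall fun t => norm_nonneg _) ?_ hlim
    filter_upwards [eventually_ge_atTop 0] with t ht
    apply Real.le_sqrt_of_sq_le
    have h1 := hip_ray t ht
    have h2 := one_sub_normSq_pos (hγ t ht).1
    rw [← h1, norm_sub_rev, invPoisson, le_div_iff₀ h2]
    nlinarith [sq_nonneg ‖ζ.1 - (γ t).1‖, sq_nonneg ‖(γ t).1‖]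
  · refine ⟨(1 + timeCoord a + ‖spaceCoord a‖) / 2, by positivity, fun t ht => ?_⟩
    obtain ⟨h1, h2, h3, h4⟩ := hγ t ht
    have h5 := one_add_timeCoord h1
    have h6 := one_sub_normSq_pos h1
    set T := timeCoord (γ t) with hT
    have hT0 : 0 < T := timeCoord_pos h1
    rw [← h3] at h2
    have h7 : ζ.1 - (γ t).1 = (1 + T)⁻¹ •
        ((1 + Real.exp (-t) * timeCoord a) • ζ.1 - Real.exp (-t) • spaceCoord a) := by
      have h8 : ζ.1 = (1 + T)⁻¹ • ((1 + T) • ζ.1) := by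
        rw [smul_smul, inv_mul_cancel₀ (by positivity), one_smul]
      rw [h2]
      nth_rw 1 [h8]
      rw [← smul_sub, h3]
      congr 1
      module
    have h9 : 1 - ‖(γ t).1‖ ^ 2 = 2 * (1 + T)⁻¹ := by
      rw [h5]
      field_simp
    have he : Real.exp (-t) ≤ 1 := Real.exp_le_one_iff.2 (by linarith)
    have h10 : ‖(1 + Real.exp (-t) * timeCoord a) • ζ.1 - Real.exp (-t) • spaceCoord a‖ ≤
        1 + timeCoord a + ‖spaceCoord a‖ := by
      refine (norm_sub_le _ _).trans ?_
      rw [norm_smul, norm_smul, hζ1, Real.norm_of_nonneg (by positivity),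
        Real.norm_of_nonneg (by positivity), mul_one]
      have := Real.exp_pos (-t)
      gcongr
      · exact mul_le_of_le_one_left hτ.le he
      · exact mul_le_of_le_one_left (norm_nonneg _) he
    rw [h7, h9, norm_smul, Real.norm_of_nonneg (by positivity)]
    calc (1 + T)⁻¹ * _ ≤ (1 + T)⁻¹ * (1 + timeCoord a + ‖spaceCoord a‖) := by gcongr
      _ = _ := by ring

/-- The geodesic ray from the centre of a Dirichlet domain to a point of its boundary at infinity
stays inside the domain, although the boundary point may be shared by several translates. -/
theorem IsKleinian.exists_ray_in_dirichletDomain (hG : IsKleinian G) {a ζ : ClosedUnitBall N}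
    (ha : a ∈ hypSpace N) (hfree : ∀ g ∈ G, g a = a → g = 1) (hζ : ζ ∈ dirichletBoundary G a) :
    ∃ γ : ℝ → ClosedUnitBall N, IsGeodesicRay γ ζ ∧ (∀ t, 0 ≤ t → γ t ∈ dirichletDomain G a) ∧
      ∃ C, 0 ≤ C ∧ ∀ t, 0 ≤ t → ‖ζ.1 - (γ t).1‖ ≤ C * (1 - ‖(γ t).1‖ ^ 2) := by
  obtain ⟨γ, hγ, hdist, hC⟩ := exists_geodesicRay ha hζ.1
  refine ⟨γ, hγ, fun t ht => ⟨hγ.mem t ht, fun g hg hne => hypDist_lt_hypDist ?_⟩, hC⟩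
  have hga := hG.apply_mem_hypSpace hg ha
  rw [hdist t ht a ha, hdist t ht _ hga, coshDist_self]
  have hip := invPoisson_pos ha hζ.1
  have h1 : 1 < coshDist a (g a) := one_lt_coshDist ha hga fun h => hne (hfree g hg h.symm)
  have h2 : invPoisson a ζ / invPoisson a ζ ≤ invPoisson (g a) ζ / invPoisson a ζ := by
    have := hζ.2 g hg
    gcongr
  have h3 : 0 ≤ Real.sinh t := Real.sinh_nonneg_iff.2 ht
  have h4 := Real.exp_pos (-t)
  have h5 := mul_le_mul_of_nonneg_left h2 h3
  nlinarith

/-! ### The limit of the orbit measures along a ray -/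

/-- A Harnack inequality at points from which `ζ` is nontangentially close, with a constant
independent of the map. -/
theorem IsConformalAut.confDeriv_le (hg : IsConformalAut g) {z ζ : ClosedUnitBall N}
    (hζ : ζ ∈ bdSphere N) {C : ℝ} (hC : 0 ≤ C)
    (h : ‖ζ.1 - z.1‖ ≤ C * (1 - ‖z.1‖ ^ 2)) :
    confDeriv g z ≤ (1 + 2 * C) ^ 2 * confDeriv g ζ := by
  have hw := hg.symm_origin_mem
  rw [confDeriv_eq, confDeriv_eq, confDen_of_mem_bdSphere hζ]
  set w := g.symm (origin N)
  have h1 := one_sub_normSq_pos hw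
  have h2 := normSq_sub_pos hw hζ
  have h3 := confDen_pos z hw
  have h4 : ‖z.1 - w.1‖ ≤ √(confDen z w) := by
    apply Real.le_sqrt_of_sq_le
    rw [confDen_eq]
    have := mul_nonneg (one_sub_normSq_nonneg z) (one_sub_normSq_nonneg w)
    linarith
  have h5 : 1 - ‖z.1‖ ≤ √(confDen z w) := Real.le_sqrt_of_sq_le (sq_one_sub_norm_left_le z w)
  have h6 : ‖ζ.1 - w.1‖ ≤ (1 + 2 * C) * √(confDen z w) := by
    have h7 := norm_sub_le_norm_sub_add_norm_sub ζ.1 z.1 w.1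
    have h8 : 1 - ‖z.1‖ ^ 2 ≤ 2 * √(confDen z w) := by
      nlinarith [norm_nonneg z.1, norm_le_one z]
    nlinarith [mul_le_mul_of_nonneg_left h8 hC]
  have h9 : ‖ζ.1 - w.1‖ ^ 2 ≤ (1 + 2 * C) ^ 2 * confDen z w := by
    have := pow_le_pow_left₀ (norm_nonneg _) h6 2
    rwa [mul_pow, Real.sq_sqrt h3.le] at this
  rw [mul_div_assoc', div_le_div_iff₀ h3 h2]
  nlinarith [mul_le_mul_of_nonneg_left h9 h1.le]

theorem IsConformalAut.weight_le (hg : IsConformalAut g) {z ζ : ClosedUnitBall N}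
    (hζ : ζ ∈ bdSphere N) {C s : ℝ} (hs : 0 < s) (hC : 0 ≤ C)
    (h : ‖ζ.1 - z.1‖ ≤ C * (1 - ‖z.1‖ ^ 2)) :
    confDeriv g z ^ s ≤ ((1 + 2 * C) ^ 2) ^ s * confDeriv g ζ ^ s := by
  rw [← Real.mul_rpow (by positivity) (hg.confDeriv_pos ζ).le]
  exact Real.rpow_le_rpow (hg.confDeriv_pos z).le (hg.confDeriv_le hζ hC h) hs.le

theorem IsKleinian.poincareSeries_lt_top (hG : IsKleinian G) {z ζ : ClosedUnitBall N} {s : ℝ}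
    (hs : 0 < s) (hz : z ∈ hypSpace N) (hζ : ζ ∈ bdSphere N) (hP : poincareSeries G ζ s < ⊤) :
    poincareSeries G z s < ⊤ := by
  have h1 := one_sub_normSq_pos hz
  have h2 : ‖ζ.1 - z.1‖ ≤ 2 / (1 - ‖z.1‖ ^ 2) * (1 - ‖z.1‖ ^ 2) := by
    rw [div_mul_cancel₀ _ h1.ne']
    have := norm_sub_le ζ.1 z.1
    linarith [norm_le_one z, norm_le_one ζ]
  refine lt_of_le_of_lt (ENNReal.tsum_le_tsum fun g =>
    ENNReal.ofReal_le_ofReal ((hG.conformal g.1 g.2).weight_le hζ hs (by positivity) h2)) ?_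
  simp_rw [ENNReal.ofReal_mul (Real.rpow_nonneg (sq_nonneg (1 + 2 * (2 / (1 - ‖z.1‖ ^ 2)))) s)]
  rw [ENNReal.tsum_mul_left]
  exact ENNReal.mul_lt_top ENNReal.ofReal_lt_top hP

theorem IsKleinian.poincareSeries_ne_zero (hG : IsKleinian G) (z : ClosedUnitBall N) (s : ℝ) :
    poincareSeries G z s ≠ 0 := by
  rw [poincareSeries, ne_eq, ENNReal.tsum_eq_zero]
  push Not
  exact ⟨1, (ENNReal.ofReal_pos.2
    (Real.rpow_pos_of_pos ((hG.conformal _ G.one_mem).confDeriv_pos z) s)).ne'⟩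

theorem IsKleinian.summable_weight (hG : IsKleinian G) {z : ClosedUnitBall N} {s : ℝ}
    (hP : poincareSeries G z s < ⊤) : Summable fun g : G => confDeriv g.1 z ^ s := by
  have h := ENNReal.summable_toReal hP.ne
  refine h.congr fun g => ENNReal.toReal_ofReal ?_
  exact Real.rpow_nonneg ((hG.conformal _ g.2).confDeriv_pos z).le s

theorem lintegral_orbitMeasure {f : ClosedUnitBall N → ENNReal} (hf : Measurable f) (s : ℝ)
    (z : ClosedUnitBall N) : ∫⁻ x, f x ∂(orbitMeasure G s z) =
      (poincareSeries G z s)⁻¹ * ∑' g : G, ENNReal.ofReal (confDeriv g.1 z ^ s) * f (g.1 z) := by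
  rw [orbitMeasure, lintegral_smul_measure, lintegral_sum_measure, smul_eq_mul]
  congr 2
  ext g
  rw [lintegral_smul_measure, lintegral_dirac' _ hf, smul_eq_mul]

theorem orbitMeasure_apply {B : Set (ClosedUnitBall N)} (hB : MeasurableSet B) (s : ℝ)
    (z : ClosedUnitBall N) : orbitMeasure G s z B = (poincareSeries G z s)⁻¹ *
      ∑' g : G, ENNReal.ofReal (confDeriv g.1 z ^ s) * B.indicator 1 (g.1 z) := by
  rw [← lintegral_indicator_one hB, lintegral_orbitMeasure (measurable_one.indicator hB)]

theorem IsKleinian.isProbabilityMeasure_orbitMeasure (hG : IsKleinian G) {z : ClosedUnitBall N}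
    {s : ℝ} (hP : poincareSeries G z s < ⊤) : IsProbabilityMeasure (orbitMeasure G s z) := by
  refine ⟨?_⟩
  rw [orbitMeasure_apply MeasurableSet.univ]
  simp only [indicator_univ, Pi.one_apply, mul_one]
  exact ENNReal.inv_mul_cancel (hG.poincareSeries_ne_zero z s) hP.ne

theorem IsKleinian.integral_orbitMeasure (hG : IsKleinian G) {z : ClosedUnitBall N} {s : ℝ}
    (hP : poincareSeries G z s < ⊤) (f : C(ClosedUnitBall N, ℝ)) :
    ∫ x, f x ∂(orbitMeasure G s z) =
      (∑' g : G, confDeriv g.1 z ^ s)⁻¹ * ∑' g : G, confDeriv g.1 z ^ s * f (g.1 z) := by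
  have hw : ∀ g : G, 0 ≤ confDeriv g.1 z ^ s := fun g =>
    Real.rpow_nonneg ((hG.conformal _ g.2).confDeriv_pos z).le s
  have hfin : IsFiniteMeasure (Measure.sum fun g : G =>
      ENNReal.ofReal (confDeriv g.1 z ^ s) • Measure.dirac (g.1 z)) := by
    refine ⟨?_⟩
    rw [Measure.sum_apply _ MeasurableSet.univ]
    simpa [poincareSeries] using hP
  rw [orbitMeasure, integral_smul_measure, integral_sum_measure, smul_eq_mul, ENNReal.toReal_inv]
  · congr 2
    · rw [poincareSeries, ENNReal.tsum_toReal_eq fun _ => ENNReal.ofReal_ne_top]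
      simp_rw [ENNReal.toReal_ofReal (hw _)]
    · ext g
      rw [integral_smul_measure, integral_dirac, ENNReal.toReal_ofReal (hw g), smul_eq_mul]
  · exact f.continuous.integrable_of_hasCompactSupport (HasCompactSupport.of_compactSpace _)

/-- Along a sequence approaching `ζ` nontangentially the weights are dominated by those at `ζ`, so
the orbit measures converge to the one at `ζ`. -/
theorem IsKleinian.tendsto_orbitMeasure (hG : IsKleinian G) {ζ : ClosedUnitBall N} {s : ℝ}
    (hs : 0 < s) (hζ : ζ ∈ bdSphere N) (hP : poincareSeries G ζ s < ⊤)
    {z : ℕ → ClosedUnitBall N} (hz : ∀ n, z n ∈ hypSpace N) (hlim : Tendsto z atTop (𝓝 ζ))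
    {C : ℝ} (hC : 0 ≤ C) (hnt : ∀ n, ‖ζ.1 - (z n).1‖ ≤ C * (1 - ‖(z n).1‖ ^ 2))
    (f : C(ClosedUnitBall N, ℝ)) :
    Tendsto (fun n => ∫ x, f x ∂(orbitMeasure G s (z n))) atTop
      (𝓝 (∫ x, f x ∂(orbitMeasure G s ζ))) := by
  have hw : ∀ (g : G) z, 0 < confDeriv g.1 z ^ s := fun g z =>
    Real.rpow_pos_of_pos ((hG.conformal _ g.2).confDeriv_pos z) s
  have hsum := hG.summable_weight hP
  have key : ∀ f : C(ClosedUnitBall N, ℝ),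
      Tendsto (fun n => ∑' g : G, confDeriv g.1 (z n) ^ s * f (g.1 (z n))) atTop
        (𝓝 (∑' g : G, confDeriv g.1 ζ ^ s * f (g.1 ζ))) := by
    intro f
    refine tendsto_tsum_of_dominated_convergence
      (bound := fun g : G => ((1 + 2 * C) ^ 2) ^ s * confDeriv g.1 ζ ^ s * ‖f‖)
      ((hsum.mul_left _).mul_right _) (fun g => ?_) (Eventually.of_forall fun n g => ?_)
    · have h1 := hG.continuous_weight s g.2
      have h2 : Continuous fun x => confDeriv g.1 x ^ s * f (g.1 x) :=
        h1.mul (f.continuous.comp g.1.continuous)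
      exact (h2.tendsto ζ).comp hlim
    · rw [norm_mul, Real.norm_of_nonneg (hw g _).le]
      have := (hG.conformal _ g.2).weight_le hζ hs hC (hnt n)
      have := f.norm_coe_le_norm (g.1 (z n))
      have := mul_nonneg (Real.rpow_nonneg (sq_nonneg (1 + 2 * C)) s) (hw g ζ).le
      gcongr
  have hP' : ∀ n, poincareSeries G (z n) s < ⊤ := fun n => hG.poincareSeries_lt_top hs (hz n) hζ hP
  simp_rw [fun n => hG.integral_orbitMeasure (hP' n) f]
  rw [hG.integral_orbitMeasure hP f]
  have h1 := key 1
  simp only [ContinuousMap.one_apply, mul_one] at h1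
  exact (h1.inv₀ (hsum.tsum_pos (fun g => (hw g ζ).le) 1 (hw 1 ζ)).ne').mul (key f)

/-- The orbit measure of any point at which the Poincaré series converges is conformal: this is
the chain rule for the conformal derivative. -/
theorem IsKleinian.isConformalMeasure_orbitMeasure (hG : IsKleinian G) {ζ : ClosedUnitBall N}
    {s : ℝ} (hP : poincareSeries G ζ s < ⊤) : IsConformalMeasure G s (orbitMeasure G s ζ) := by
  refine ⟨hG.isProbabilityMeasure_orbitMeasure hP, fun h hh B hB => ?_⟩
  have h1 : MeasurableSet (h '' B) := by
    rw [Homeomorph.image_eq_preimage_symm]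
    exact h.symm.continuous.measurable hB
  rw [orbitMeasure_apply h1, ← lintegral_indicator hB, lintegral_orbitMeasure
    ((hG.continuous_weight s hh).measurable.ennreal_ofReal.indicator hB),
    ← (Equiv.mulLeft (⟨h, hh⟩ : G)).tsum_eq]
  congr 2
  ext g
  have h2 : (Equiv.mulLeft (⟨h, hh⟩ : G) g).1 = h * g.1 := rfl
  have h3 : (h * g.1) ζ = h (g.1 ζ) := rfl
  rw [h2, hG.confDeriv_mul hh g.2, h3]
  by_cases hx : g.1 ζ ∈ B
  · rw [indicator_of_mem hx, indicator_of_mem (mem_image_of_mem h hx), Pi.one_apply, mul_one,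
      Real.mul_rpow ((hG.conformal _ hh).confDeriv_pos _).le
        ((hG.conformal _ g.2).confDeriv_pos _).le,
      mul_comm, ENNReal.ofReal_mul (Real.rpow_nonneg ((hG.conformal _ g.2).confDeriv_pos _).le s)]
  · have h4 : h (g.1 ζ) ∉ h '' B := fun h' => hx (h.injective.mem_set_image.1 h')
    rw [indicator_of_notMem hx, indicator_of_notMem h4, mul_zero, mul_zero]

theorem orbitMeasure_eq_zero {B : Set (ClosedUnitBall N)} (hB : MeasurableSet B) (s : ℝ)
    {z : ClosedUnitBall N} (h : ∀ g ∈ G, g z ∉ B) : orbitMeasure G s z B = 0 := by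
  rw [orbitMeasure_apply hB]
  have : ∀ g : G, ENNReal.ofReal (confDeriv g.1 z ^ s) * B.indicator 1 (g.1 z) = 0 := fun g => by
    rw [indicator_of_notMem (h g.1 g.2), mul_zero]
  simp [this]

/-! ### Parabolic fixed points -/

theorem IsKleinian.confDeriv_pow (hG : IsKleinian G) (hg : g ∈ G) {z : ClosedUnitBall N}
    (hz : g z = z) (n : ℕ) : confDeriv (g ^ n) z = confDeriv g z ^ n := by
  have hone : confDeriv (1 : ClosedUnitBall N ≃ₜ ClosedUnitBall N) z = 1 := by
    have h := hG.confDeriv_mul G.one_mem G.one_mem z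
    rw [mul_one] at h
    have h1 := (hG.conformal _ G.one_mem).confDeriv_pos z
    exact (mul_eq_left₀ h1.ne').1 h.symm
  induction n with
  | zero => rw [pow_zero, pow_zero, hone]
  | succ n ih => rw [pow_succ, pow_succ, hG.confDeriv_mul (G.pow_mem hg n) hg, hz, ih]

/-- At a fixed point of an element of infinite order the Poincaré series has infinitely many terms
at least `1`, coming from the powers of the element or of its inverse. -/
theorem IsKleinian.isOfFinOrder_of_fixed (hG : IsKleinian G) (hg : g ∈ G) {z : ClosedUnitBall N}
    {s : ℝ} (hs : 0 < s) (hz : g z = z) (hP : poincareSeries G z s < ⊤) : IsOfFinOrder g := by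
  have key : ∀ h ∈ G, h z = z → 1 ≤ confDeriv h z → IsOfFinOrder h := by
    intro h hh hz h1
    by_contra hinf
    have hinj : Function.Injective fun n : ℕ => (⟨h ^ n, G.pow_mem hh n⟩ : G) := fun m n hmn =>
      injective_pow_iff_not_isOfFinOrder.2 hinf (congrArg Subtype.val hmn)
    have h2 := ENNReal.tsum_comp_le_tsum_of_injective hinj
      fun k : G => ENNReal.ofReal (confDeriv k.1 z ^ s)
    have h3 : (∑' _ : ℕ, (1 : ENNReal)) ≤
        ∑' n : ℕ, ENNReal.ofReal (confDeriv (h ^ n) z ^ s) := by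
      refine ENNReal.tsum_le_tsum fun n => ?_
      rw [hG.confDeriv_pow hh hz, ENNReal.one_le_ofReal]
      exact Real.one_le_rpow (one_le_pow₀ h1) hs.le
    rw [ENNReal.tsum_const_eq_top_of_ne_zero one_ne_zero] at h3
    exact hP.ne (top_le_iff.1 (h3.trans h2))
  by_cases h1 : 1 ≤ confDeriv g z
  · exact key g hg hz h1
  · have hinv : g⁻¹ z = z := (g.symm_apply_eq).2 hz.symm
    have h2 := hG.confDeriv_mul (G.inv_mem hg) hg z
    have h3 := hG.confDeriv_pow hg hz 0
    rw [pow_zero, pow_zero] at h3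
    rw [inv_mul_cancel, h3, hz] at h2
    have h4 := (hG.conformal _ hg).confDeriv_pos z
    have h5 := (hG.conformal _ (G.inv_mem hg)).confDeriv_pos z
    exact isOfFinOrder_inv_iff.1 (key _ (G.inv_mem hg) hinv (by nlinarith))

/-- The hyperbolic barycentre of a finite orbit: the distance function from it is invariant. -/
theorem IsKleinian.exists_invariant_centre (hG : IsKleinian G) (hg : g ∈ G)
    (hfin : IsOfFinOrder g) :
    ∃ c ∈ hypSpace N, ∀ z ∈ hypSpace N, coshDist c (g z) = coshDist c z := by
  obtain ⟨n, hn, hgn⟩ := isOfFinOrder_iff_pow_eq_one.1 hfin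
  set o : ℕ → ClosedUnitBall N := fun k => (g ^ k) (origin N) with ho
  have hmem : ∀ k, o k ∈ hypSpace N := fun k =>
    hG.apply_mem_hypSpace (G.pow_mem hg k) origin_mem_hypSpace
  set T := ∑ k ∈ Finset.range n, timeCoord (o k) with hT
  set X := ∑ k ∈ Finset.range n, spaceCoord (o k) with hX
  have hlt : ‖X‖ < T := by
    refine (norm_sum_le _ _).trans_lt (Finset.sum_lt_sum_of_nonempty ?_ fun k _ =>
      norm_spaceCoord_lt (hmem k))
    exact Finset.nonempty_range_iff.2 hn.ne'
  have hT0 : 0 < T := (norm_nonneg X).trans_lt hlt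
  have hq : 0 < T ^ 2 - ‖X‖ ^ 2 := by nlinarith [norm_nonneg X]
  set m := √(T ^ 2 - ‖X‖ ^ 2) with hm
  have hm0 : 0 < m := Real.sqrt_pos.2 hq
  have hm2 : m ^ 2 = T ^ 2 - ‖X‖ ^ 2 := Real.sq_sqrt hq.le
  obtain ⟨c, hc, -, hcT, hcX⟩ := exists_of_hyperboloid (t := m⁻¹ * T) (x := m⁻¹ • X)
    (by positivity) (by
      rw [norm_smul, mul_pow, mul_pow, norm_inv, Real.norm_of_nonneg hm0.le]
      field_simp
      linarith)
  have hdist : ∀ z ∈ hypSpace N, coshDist c z =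
      m⁻¹ * ∑ k ∈ Finset.range n, coshDist (o k) z := by
    intro z hz
    rw [coshDist_eq_lorentz hc hz, hcT, hcX, Finset.sum_congr rfl fun k _ =>
      coshDist_eq_lorentz (hmem k) hz, Finset.sum_sub_distrib, ← Finset.sum_mul, ← sum_inner,
      inner_smul_left, conj_trivial]
    ring
  refine ⟨c, hc, fun z hz => ?_⟩
  have hgz := hG.apply_mem_hypSpace hg hz
  rw [hdist _ hgz, hdist z hz]
  congr 1
  -- Shifting the index by one permutes the orbit cyclically.
  have hshift : ∀ k, coshDist (o (k + 1)) (g z) = coshDist (o k) z := fun k => by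
    have : o (k + 1) = g (o k) := by
      simp only [ho]
      rw [pow_succ']
      rfl
    rw [this, (hG.conformal g hg).coshDist_apply (hmem k) hz]
  have h0 : o n = o 0 := by
    simp only [ho]
    rw [hgn, pow_zero]
  have h1 := Finset.sum_range_succ (fun k => coshDist (o k) (g z)) n
  have h2 := Finset.sum_range_succ' (fun k => coshDist (o k) (g z)) n
  simp only [hshift, h0] at h1 h2
  linarith

/-- An element of finite order fixing a boundary point fixes a second one, namely the other end of
the geodesic from the first one through the barycentre of an orbit. -/
theorem IsKleinian.exists_second_fixed_point (hG : IsKleinian G) (hg : g ∈ G)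
    (hfin : IsOfFinOrder g) {ζ : ClosedUnitBall N} (hζ : ζ ∈ bdSphere N) (hgζ : g ζ = ζ) :
    ∃ η ∈ bdSphere N, η ≠ ζ ∧ g η = η := by
  have hg' := hG.conformal g hg
  obtain ⟨c, hc, hcinv⟩ := hG.exists_invariant_centre hg hfin
  have hj : confDeriv g ζ = 1 := by
    obtain ⟨n, hn, hgn⟩ := isOfFinOrder_iff_pow_eq_one.1 hfin
    have h1 := hG.confDeriv_pow hg hgζ n
    have h2 := hG.confDeriv_pow hg hgζ 0
    rw [pow_zero, pow_zero] at h2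
    rw [hgn, h2] at h1
    exact (pow_eq_one_iff_of_nonneg (hg'.confDeriv_pos ζ).le hn.ne').1 h1.symm
  have hζinv : ∀ z, invPoisson (g z) ζ = invPoisson z ζ := fun z => by
    have := hg'.invPoisson_apply z ζ
    rwa [hgζ, hj, one_mul] at this
  have hζ1 : ‖ζ.1‖ = 1 := hζ
  have hip := invPoisson_pos hc hζ
  have hlor := invPoisson_eq_lorentz (z := c) hζ
  have hτ := timeCoord_sq hc
  have hσ := norm_spaceCoord_lt hc
  set k := (invPoisson c ζ)⁻¹ with hk
  have hk0 : 0 < k := inv_pos.2 hip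
  have hki : k * invPoisson c ζ = 1 := inv_mul_cancel₀ hip.ne'
  -- The lightlike vector `2 c - k ζ` spans the other end of the geodesic.
  set y := (2 : ℝ) • spaceCoord c - k • ζ.1 with hy
  set m := 2 * timeCoord c - k with hm
  have hm0 : 0 < m := by
    have h1 : ⟪spaceCoord c, ζ.1⟫ ≤ ‖spaceCoord c‖ := by
      simpa [hζ1] using real_inner_le_norm (spaceCoord c) ζ.1
    have h2 : k * (timeCoord c - ‖spaceCoord c‖) ≤ 1 := by
      rw [← hki, hlor]
      gcongr
    have h3 : k ≤ timeCoord c + ‖spaceCoord c‖ := by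
      have h4 : 0 < timeCoord c - ‖spaceCoord c‖ := by linarith
      refine le_of_mul_le_mul_right (h2.trans (le_of_eq ?_)) h4
      linear_combination -hτ
    linarith
  have hym : ‖y‖ ^ 2 = m ^ 2 := by
    rw [hy, norm_sub_sq_real, norm_smul, norm_smul, inner_smul_left, inner_smul_right, hζ1, mul_pow,
      mul_pow, Real.norm_eq_abs, Real.norm_eq_abs, sq_abs, sq_abs, conj_trivial, hm]
    rw [hlor] at hki
    linear_combination (-4) * hτ + 4 * hki
  have hyn : ‖y‖ = m := (sq_eq_sq₀ (norm_nonneg _) hm0.le).1 hym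
  have hη1 : ‖m⁻¹ • y‖ = 1 := by
    rw [norm_smul, norm_inv, Real.norm_of_nonneg hm0.le, hyn, inv_mul_cancel₀ hm0.ne']
  set η : ClosedUnitBall N := ⟨m⁻¹ • y, mem_closedBall_zero_iff.2 hη1.le⟩ with hη
  have hηS : η ∈ bdSphere N := hη1
  have hform : ∀ z ∈ hypSpace N, m * invPoisson z η = 2 * coshDist c z - k * invPoisson z ζ := by
    intro z hz
    have h1 : η.1 = m⁻¹ • y := rfl
    rw [invPoisson_eq_lorentz hηS, invPoisson_eq_lorentz hζ, coshDist_eq_lorentz hc hz, h1,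
      inner_smul_right, mul_sub, mul_inv_cancel_left₀ hm0.ne', hy, inner_sub_right,
      inner_smul_right, inner_smul_right, hm, real_inner_comm (spaceCoord z)]
    ring
  have hηinv : ∀ z ∈ hypSpace N, invPoisson (g z) η = invPoisson z η := by
    intro z hz
    apply mul_left_cancel₀ hm0.ne'
    rw [hform _ (hG.apply_mem_hypSpace hg hz), hform z hz, hcinv z hz, hζinv]
  refine ⟨η, hηS, fun heq => ?_, ?_⟩
  · have h1 := hform c hc
    rw [heq, coshDist_self, hki] at h1
    have h2 : m = k := mul_right_cancel₀ hip.ne' (by linarith)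
    have h3 : k = timeCoord c := by linarith
    have h4 : ζ.1 = m⁻¹ • y := by rw [← heq]
    have h5 : y = k • ζ.1 := by
      rw [h4, h2, smul_smul, mul_inv_cancel₀ hk0.ne', one_smul]
    have h6 : spaceCoord c = k • ζ.1 := by
      have h7 : (2 : ℝ) • spaceCoord c = (2 : ℝ) • (k • ζ.1) := by
        rw [two_smul ℝ (k • ζ.1)]
        exact sub_eq_iff_eq_add.1 h5
      exact smul_right_injective _ two_ne_zero h7
    rw [h6, norm_smul, hζ1, Real.norm_of_nonneg hk0.le, mul_one] at hσ
    linarith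
  · have hEq : ∀ z, ‖(g η).1 - (g z).1‖ ^ 2 = confDeriv g η * ‖η.1 - (g z).1‖ ^ 2 := by
      have hc' := g.continuous
      refine congrFun (Continuous.ext_on dense_hypSpace
        (f := fun z => ‖(g η).1 - (g z).1‖ ^ 2)
        (g := fun z => confDeriv g η * ‖η.1 - (g z).1‖ ^ 2) (by fun_prop) (by fun_prop) ?_)
      intro z hz
      have h1 := hg'.invPoisson_apply z η
      rw [← hηinv z hz, invPoisson, invPoisson, ← mul_div_assoc] at h1
      exact (div_left_inj' (one_sub_normSq_pos (hG.apply_mem_hypSpace hg hz)).ne').1 h1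
    have h1 := hEq η
    rw [sub_self, norm_zero, zero_pow two_ne_zero, eq_comm, mul_eq_zero] at h1
    have h2 := h1.resolve_left (hg'.confDeriv_pos η).ne'
    rw [sq_eq_zero_iff, norm_eq_zero, sub_eq_zero] at h2
    exact (Subtype.ext h2).symm

theorem IsKleinian.not_isParabolic_of_fixed (hG : IsKleinian G) (hg : g ∈ G)
    {ζ : ClosedUnitBall N} (hζ : ζ ∈ bdSphere N) {s : ℝ} (hs : 0 < s) (hgζ : g ζ = ζ)
    (hP : poincareSeries G ζ s < ⊤) : ¬ IsParabolic g := by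
  rintro ⟨-, hunique⟩
  obtain ⟨η, hη, hne, hgη⟩ := hG.exists_second_fixed_point hg
    (hG.isOfFinOrder_of_fixed hg hs hgζ hP) hζ hgζ
  exact hne (hunique.unique ⟨hη, hgη⟩ ⟨hζ, hgζ⟩)

theorem IsKleinian.poincareSeries_apply_lt_top (hG : IsKleinian G) (hg : g ∈ G)
    {z : ClosedUnitBall N} {s : ℝ} (hP : poincareSeries G z s < ⊤) :
    poincareSeries G (g z) s < ⊤ := by
  have h1 : poincareSeries G z s =
      poincareSeries G (g z) s * ENNReal.ofReal (confDeriv g z ^ s) := by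
    rw [poincareSeries, poincareSeries, ← ENNReal.tsum_mul_right,
      ← (Equiv.mulRight (⟨g, hg⟩ : G)).tsum_eq]
    congr 1
    ext k
    have h2 : (Equiv.mulRight (⟨g, hg⟩ : G) k).1 = k.1 * g := rfl
    rw [h2, hG.confDeriv_mul k.2 hg, Real.mul_rpow ((hG.conformal _ k.2).confDeriv_pos _).le
      ((hG.conformal _ hg).confDeriv_pos _).le,
      ENNReal.ofReal_mul (Real.rpow_nonneg ((hG.conformal _ k.2).confDeriv_pos _).le s)]
  by_contra htop
  rw [not_lt, top_le_iff] at htop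
  rw [htop, ENNReal.top_mul (ENNReal.ofReal_pos.2
    (Real.rpow_pos_of_pos ((hG.conformal _ hg).confDeriv_pos z) s)).ne'] at h1
  exact hP.ne h1

end Kleinian

end

theorem mainTheorem6 (N : ℕ) (hN : 1 ≤ N)
    (G : Subgroup (Kleinian.ClosedUnitBall N ≃ₜ Kleinian.ClosedUnitBall N))
    (hG : Kleinian.IsKleinian G) (s : ℝ) (hs : 0 < s)
    (A : Set (Kleinian.ClosedUnitBall N)) (hAS : A ⊆ Kleinian.bdSphere N)
    (hA : MeasurableSet A) (hinv : ∀ g ∈ G, g '' A = A)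
    (μ : MeasureTheory.Measure (Kleinian.ClosedUnitBall N))
    (hμ : Kleinian.IsConformalMeasure G s μ)
    (hpos : 0 < μ (A \ Kleinian.bigHorosphericalLimitSet G)) :
    ∃ ν : MeasureTheory.Measure (Kleinian.ClosedUnitBall N),
      Kleinian.IsEndingMeasure G s ν ∧ Kleinian.IsConformalMeasure G s ν ∧
      Kleinian.IsPurelyAtomic ν ∧ ν Aᶜ = 0 ∧
      ∀ z, ν {z} ≠ 0 → ∀ g ∈ G, Kleinian.IsParabolic g → g z ≠ z := by
  obtain ⟨a, ha, hfree⟩ := hG.exists_trivial_stabilizer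
  obtain ⟨ζ, hζA, hζD, hP⟩ := hG.exists_mem_dirichletBoundary hAS hA hinv hμ hpos ha
  have hζ := hAS hζA
  obtain ⟨γ, hγ, hγD, C, hC, hnt⟩ := hG.exists_ray_in_dirichletDomain ha hfree hζD
  have hlim : Tendsto (fun n : ℕ => γ n) atTop (𝓝 ζ) :=
    hγ.tendsto.comp tendsto_natCast_atTop_atTop
  have hcount := hG.countable
  refine ⟨Kleinian.orbitMeasure G s ζ, ⟨hG.isProbabilityMeasure_orbitMeasure hP,
    fun z hz => hG.poincareSeries_lt_top hs hz hζ hP, Kleinian.dirichletDomain G a, ζ,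
    fun n => γ n, id, ⟨a, ha, hfree, rfl⟩, ⟨hζ, fun n => hγD n n.cast_nonneg,
      ⟨γ, hγ, hγD, 0, fun n => ⟨n, n.cast_nonneg, ?_⟩⟩, hlim⟩, strictMono_id, fun f => ?_⟩,
    hG.isConformalMeasure_orbitMeasure hP, ?_, ?_, fun z hz g hg hpar hgz => ?_⟩
  · rw [hγ.isometry n n.cast_nonneg n n.cast_nonneg, sub_self, abs_zero]
  · exact hG.tendsto_orbitMeasure hs hζ hP (fun n => hγ.mem n n.cast_nonneg) hlim hC
      (fun n => hnt n n.cast_nonneg) f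
  · have hrange : (Set.range fun g : G => g.1 ζ).Countable := Set.countable_range _
    exact ⟨_, hrange, Kleinian.orbitMeasure_eq_zero hrange.measurableSet.compl s
      fun g hg h => h ⟨⟨g, hg⟩, rfl⟩⟩
  · refine Kleinian.orbitMeasure_eq_zero hA.compl s fun g hg h => h ?_
    rw [← hinv g hg]
    exact Set.mem_image_of_mem g hζA
  · by_cases hz' : ∃ h ∈ G, h ζ = z
    · obtain ⟨h, hh, rfl⟩ := hz'
      exact hG.not_isParabolic_of_fixed hg (hG.apply_mem_bdSphere hh hζ) hs hgz
        (hG.poincareSeries_apply_lt_top hh hP) hpar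
    · exact hz (Kleinian.orbitMeasure_eq_zero (measurableSet_singleton z) s
        fun h hh h' => hz' ⟨h, hh, h'⟩)
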